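/- Fix $\nu\in(2,3]$. For kernels $k_u,k_v$ and vectors $x_1,\dots,x_n\in\mathbb{R}^d$ write $$u_n(x)=\frac{1}{n(n-1)}\sum_{1\le i\ne j\le n}k_u(x_i,x_j),\qquad v_n(x)=\frac1{n^2}\sum_{1\le i,j\le n}k_v(x_i,x_j).$$ Let $\xi\sim\mathcal N(0,1)$ be independent of a chi-squared variable $\chi^2_1$ with one degree of freedom, and put $\overline{\chi^2_1}=\chi^2_1-1$. For $s>0$ with $3s^{2\nu/(\nu-2)}\le 1$ let $U_s$ take the values $-6^{-1/2}s^{-2/(\nu-2)}$, $0$, $2\cdot 6^{-1/2}s^{-2/(\nu-2)}$ with probabilities $2s^{2\nu/(\nu-2)}$, $1-3s^{2\nu/(\nu-2)}$, $s^{2\nu/(\nu-2)}$, and let $Y_s=\big(\tfrac1{\sqrt2}U_s+\tfrac{s}{\sqrt2}\xi_1,\ \xi_2\big)\in\mathbb{R}^2$ with $U_s,\xi_1,\xi_2$ independent and $\xi_1,\xi_2\sim\mathcal N(0,1)$. For a measurable $\varphi:\mathbb{R}^d\to\mathbb{R}^2$ define symmetric kernels on $\mathbb{R}^d$ by $k_u(x,y)=\tilde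 k_u(\varphi(x),\varphi(y))$ and $k_v(x,y)=\tilde k_v(\varphi(x),\varphi(y))$, where $$\tilde k_u(a,b)=\frac{a_1+b_1}{2\sqrt{n-1}}+\frac{\sqrt{n-1}}{\sqrt n}\,a_2b_2,\qquad \tilde k_v(a,b)=\frac{a_1+b_1}{2\sqrt n}+a_2b_2 .$$ Theorem. There are constants $\sigma_0,c,C>0$ and $N\in\mathbb{N}$, depending only on $\nu$, such that, with $\sigma_n=\min\{\sigma_0n^{-(\nu-2)/(2\nu)},1\}$ (so that $\sigma_n\to0$ and $\sigma_n=\Theta(n^{-(\nu-2)/(2\nu)})$), the following hold. (a) There are a constant $M$ and, for all $n\in\mathbb{N}$ and $d\ge1$, a measure $\mu_{n,d}$ on $\mathbb{R}^d$ and a map $\varphi_{n,d}:\mathbb{R}^d\to\mathbb{R}^2$ with the following properties. For all $n>N$ and $d\ge1$, $\mu_{n,d}$ is a probability measure, $\varphi_{n,d}$ is measurable, $\varphi_{n,d}(X)$ has the law of $Y_{\sigma_n}$ if $X\sim\mu_{n,d}$, and $\int\|x\|^\nu\,d\mu_{n,d}(x)\le M$. For every $p>\nu$, $\int\|x\|^p\,d\mu_{n,d}(x)\to\infty$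 as $n\to\infty$, uniformly in $d\ge1$. (b) Let $n>N$ and $d\in\mathbb{N}$, let $\mu$ be any probability measure on $\mathbb{R}^d$ and $\varphi:\mathbb{R}^d\to\mathbb{R}^2$ any measurable map that takes $\mu$ to the law of $Y_{\sigma_n}$, let $k_u,k_v$ be the corresponding symmetric kernels, and let $X=(X_1,\dots,X_n)$ be i.i.d. with law $\mu$. Then $$c\,n^{-\frac{\nu-2}{4\nu}}\le\sup_{t\in\mathbb{R}}\Big|\mathbb{P}\big(\sqrt{n(n-1)}\,u_n(X)\le t\big)-\mathbb{P}\big(\sigma_n\xi+\overline{\chi^2_1}\le t\big)\Big|\le C\,n^{-\frac{\nu-2}{4\nu}},$$ $$c\,n^{-\frac{\nu-2}{4\nu}}\le\sup_{t\in\mathbb{R}}\Big|\mathbb{P}\big(n\,v_n(X)\le t\big)-\mathbb{P}\big(\sigma_n\xi+\chi^2_1\le t\big)\Big|\le C\,n^{-\frac{\nu-2}{4\nu}}.$$ (c) In particular, if $\nu=3$, then for any sequence of dimensions $d(n)$ and any choice of such $\mu$ and $\varphi$ on $\mathbb{R}^{d(n)}$ for each $n>N$, both suprema are $\Theta(n^{-1/12})$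 as $n\to\infty$. -/

import Mathlib

open MeasureTheory ProbabilityTheory Filter Topology Asymptotics
open scoped ENNReal

noncomputable section

/-- The degree-two U-statistic of the kernel `k`: the sum of `k (x i) (x j)` over ordered pairs
of distinct indices, divided by `n (n - 1)`. -/
def uStat {E : Type*} {n : ℕ} (k : E → E → ℝ) (x : Fin n → E) : ℝ :=
  (∑ i : Fin n, ∑ j : Fin n, if i ≠ j then k (x i) (x j) else 0) / ((n : ℝ) * ((n : ℝ) - 1))

/-- The degree-two V-statistic of the kernel `k`. -/
def vStat {E : Type*} {n : ℕ} (k : E → E → ℝ) (x : Fin n → E) : ℝ :=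
  (∑ i : Fin n, ∑ j : Fin n, k (x i) (x j)) / (n : ℝ) ^ 2

/-- The chi-squared law with one degree of freedom: the law of the square of a standard
normal variable. -/
def chiSqOne : Measure ℝ := (gaussianReal 0 1).map (fun x : ℝ => x ^ 2)

/-- The joint law of `(ξ, χ)` with `ξ` standard normal, `χ` chi-squared with one degree of
freedom, and `ξ`, `χ` independent. -/
def gaussChi : Measure (ℝ × ℝ) := (gaussianReal 0 1).prod chiSqOne

/-- The sequence `σ_n = min {σ₀ n ^ (-(ν - 2) / (2 ν)), 1}`. -/
def sigmaSeq (ν σ₀ : ℝ) (n : ℕ) : ℝ := min (σ₀ * (n : ℝ) ^ (-(ν - 2) / (2 * ν))) 1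

/-- The law of the three-point variable `U_s`. It has total mass one exactly when the three
weights are probabilities, i.e. when `3 s ^ (2 ν / (ν - 2)) ≤ 1`. -/
def threePointLaw (ν s : ℝ) : Measure ℝ :=
  ENNReal.ofReal (2 * s ^ (2 * ν / (ν - 2))) •
      Measure.dirac (-((Real.sqrt 6)⁻¹ * s ^ (-2 / (ν - 2)))) +
    ENNReal.ofReal (1 - 3 * s ^ (2 * ν / (ν - 2))) • Measure.dirac 0 +
    ENNReal.ofReal (s ^ (2 * ν / (ν - 2))) •
      Measure.dirac (2 * (Real.sqrt 6)⁻¹ * s ^ (-2 / (ν - 2)))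

/-- The law on the plane of `Y = (U_s / √2 + s ξ₁ / √2, ξ₂)`, with `U_s`, `ξ₁`, `ξ₂` independent
and `ξ₁`, `ξ₂` standard normal. -/
def planeLaw (ν s : ℝ) : Measure (ℝ × ℝ) :=
  ((threePointLaw ν s).prod ((gaussianReal 0 1).prod (gaussianReal 0 1))).map
    (fun p : ℝ × ℝ × ℝ => (p.1 / Real.sqrt 2 + s / Real.sqrt 2 * p.2.1, p.2.2))

/-- The planar kernel of the U-statistic. -/
def planeKernelU (n : ℕ) (a b : ℝ × ℝ) : ℝ :=
  a.1 / (2 * Real.sqrt ((n : ℝ) - 1)) + b.1 / (2 * Real.sqrt ((n : ℝ) - 1)) +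
    Real.sqrt ((n : ℝ) - 1) / Real.sqrt (n : ℝ) * (a.2 * b.2)

/-- The planar kernel of the V-statistic. -/
def planeKernelV (n : ℕ) (a b : ℝ × ℝ) : ℝ :=
  a.1 / (2 * Real.sqrt (n : ℝ)) + b.1 / (2 * Real.sqrt (n : ℝ)) + a.2 * b.2

/-- The kernel `k_u` on `ℝ^d`, pulled back from the plane by `φ`. -/
def kernelU (n : ℕ) {d : ℕ} (φ : EuclideanSpace ℝ (Fin d) → ℝ × ℝ)
    (x y : EuclideanSpace ℝ (Fin d)) : ℝ := planeKernelU n (φ x) (φ y)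

/-- The kernel `k_v` on `ℝ^d`, pulled back from the plane by `φ`. -/
def kernelV (n : ℕ) {d : ℕ} (φ : EuclideanSpace ℝ (Fin d) → ℝ × ℝ)
    (x y : EuclideanSpace ℝ (Fin d)) : ℝ := planeKernelV n (φ x) (φ y)

/-- `μ` is a probability law on `ℝ^d` and `φ : ℝ^d → ℝ²` is measurable, such that `φ X` has the
law of `Y` (with parameter `s`) whenever `X` has law `μ`. -/
structure IsRealization (ν s : ℝ) {d : ℕ} (μ : Measure (EuclideanSpace ℝ (Fin d)))
    (φ : EuclideanSpace ℝ (Fin d) → ℝ × ℝ) : Prop where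
  isProb : IsProbabilityMeasure μ
  measurable : Measurable φ
  map_eq : μ.map φ = planeLaw ν s

/-- `sup_t |P(√(n (n - 1)) u_n(X) ≤ t) - P(s ξ + (χ²₁ - 1) ≤ t)|`, where `X = (X_1, …, X_n)` is
i.i.d. with common law `μ` and `u_n` is the U-statistic of the kernel `k`. -/
def uError (s : ℝ) (n : ℕ) {d : ℕ} (μ : Measure (EuclideanSpace ℝ (Fin d)))
    (k : EuclideanSpace ℝ (Fin d) → EuclideanSpace ℝ (Fin d) → ℝ) : ℝ :=
  ⨆ t : ℝ, |(Measure.pi (fun _ : Fin n => μ)).real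
        {x | Real.sqrt ((n : ℝ) * ((n : ℝ) - 1)) * uStat k x ≤ t} -
      gaussChi.real {p | s * p.1 + (p.2 - 1) ≤ t}|

/-- `sup_t |P(n v_n(X) ≤ t) - P(s ξ + χ²₁ ≤ t)|`, where `X = (X_1, …, X_n)` is i.i.d. with common
law `μ` and `v_n` is the V-statistic of the kernel `k`. -/
def vError (s : ℝ) (n : ℕ) {d : ℕ} (μ : Measure (EuclideanSpace ℝ (Fin d)))
    (k : EuclideanSpace ℝ (Fin d) → EuclideanSpace ℝ (Fin d) → ℝ) : ℝ :=
  ⨆ t : ℝ, |(Measure.pi (fun _ : Fin n => μ)).real {x | (n : ℝ) * vStat k x ≤ t} -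
      gaussChi.real {p | s * p.1 + p.2 ≤ t}|

end

/-!
The law of the statistics is explicit. For `y i = (A_i, Z_i)` the planar kernels give
`n v_n = ∑ A_i / √n + W ^ 2` and `√(n (n - 1)) u_n = ∑ A_i / √n + W ^ 2 - ∑ Z_i ^ 2 / n`, where
`W = ∑ Z_i / √n` is standard normal and independent of the `A_i`. Moreover `∑ A_i / √n = s Q` with
`Q = (S + G) / √2`, where `G` is standard normal and `S` is the standardised sum of the `U_i`; in
particular `E Q ^ 2 = 1`. For the V-statistic one therefore has to compare the laws of `s Q + W ^ 2`
and `s ξ + W ^ 2`. For the U-statistic, Chebyshev's inequality replaces `∑ Z_i ^ 2 / n` by `1` at a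
cost of order `n ^ (-1 / 5)` (`IsRealization.abs_pi_real_uStat_le_sub`, `centring_error_le`), which
is negligible because `(ν - 2) / (4 ν) ≤ 1 / 12`.

Upper bound: the distribution function `sqCdf` of `W ^ 2` is `1/2`-Hölder, so averaging it over a
perturbation `s Q` with `E Q ^ 2 = 1` moves it by `O(√s)`, whatever the law of `Q`
(`abs_shiftedCdf_sub_sqCdf_le`). The same holds for `ξ`, and `√s` has the order
`n ^ (-(ν - 2) / (4 ν))`.

Lower bound: near `0` the function `sqCdf` behaves like a multiple of `√x`, so at `t = 0` the
distribution function of `s Q + W ^ 2` is that multiple of `√s E √(Q⁻)`, to leading order. When `s`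
is of the order `n ^ (-(ν - 2) / (2 ν))`, the expected number of nonzero `U_i` does not depend on
`n`, and it is small when `σ₀` is small. Hence `Q` equals `G / √2` with probability close to one,
and `E √(Q⁻)` stays below `E √(ξ⁻)` by a fixed amount for all `n` (`integral_sqrt_neg_mixLaw_le`,
`le_shiftedCdf_sub_mixLaw`). No limit theorem for `S` is needed.

For the existence of heavy-tailed realizations in every dimension, the first coordinate of `X` has
the integer part of `|Y.1|` as its integer part and a Borel encoding of `Y` in `[0, 1)` as its
fractional part. Its moments are then comparable with those of `|Y.1|`, hence of `U_s`, whose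
`ν`-th moment does not depend on `s` while the higher ones blow up as `s → 0`.
-/

/-! ### The chi-squared distribution function and its smoothing -/

/-- The distribution function of `χ²₁`, written through the standard normal law. -/
noncomputable def sqCdf (x : ℝ) : ℝ := (gaussianReal 0 1).real {w : ℝ | w ^ 2 ≤ x}
/-- The value `2 / √(2π)`: twice the maximum of the standard normal density, and the constant in
the asymptotics `sqCdf x ∼ sqCdfSlope * √x` at `0+`. -/
noncomputable def sqCdfSlope : ℝ := 2 * (√(2 * Real.pi))⁻¹

lemma sqCdfSlope_pos : 0 < sqCdfSlope := by
  unfold sqCdfSlope; positivity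

lemma sqCdfSlope_le_one : sqCdfSlope ≤ 1 := by
  unfold sqCdfSlope
  have h : (2 : ℝ) ≤ √(2 * Real.pi) := by
    apply Real.le_sqrt_of_sq_le
    nlinarith [Real.pi_gt_three]
  rw [← div_eq_mul_inv, div_le_one (by positivity)]
  exact h

lemma sqCdf_eq_integral (x : ℝ) :
    sqCdf x = sqCdfSlope * ∫ w in (0 : ℝ)..√x, Real.exp (-w ^ 2 / 2) := by
  have hpdf : ∀ w : ℝ, gaussianPDFReal 0 1 w = (√(2 * Real.pi))⁻¹ * Real.exp (-w ^ 2 / 2) := by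
    intro w; simp [gaussianPDFReal]
  have hcont : Continuous fun w : ℝ => Real.exp (-w ^ 2 / 2) := by fun_prop
  have hneg : ∫ w in (-√x)..(0 : ℝ), Real.exp (-w ^ 2 / 2)
      = ∫ w in (0 : ℝ)..√x, Real.exp (-w ^ 2 / 2) := by
    have := intervalIntegral.integral_comp_neg (a := 0) (b := √x)
      (fun w : ℝ => Real.exp (-w ^ 2 / 2))
    simpa using this.symm
  rcases lt_or_ge x 0 with hx | hx
  · have : {w : ℝ | w ^ 2 ≤ x} = ∅ := by
      ext w; simp only [Set.mem_ofPred_eq, Set.mem_empty_iff_false, iff_false, not_le]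
      nlinarith [sq_nonneg w]
    rw [sqCdf, this, Real.sqrt_eq_zero_of_nonpos hx.le]
    simp
  · have hset : {w : ℝ | w ^ 2 ≤ x} = Set.Icc (-√x) (√x) := by
      ext w; simp only [Set.mem_ofPred_eq, Set.mem_Icc, ← abs_le]
      exact Real.sq_le hx |>.trans abs_le.symm
    rw [sqCdf, hset, Measure.real, gaussianReal_apply_eq_integral 0 one_ne_zero,
      ENNReal.toReal_ofReal (integral_nonneg fun w => gaussianPDFReal_nonneg 0 1 w),
      integral_Icc_eq_integral_Ioc,
      ← intervalIntegral.integral_of_le (by linarith [Real.sqrt_nonneg x])]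
    simp_rw [hpdf]
    rw [intervalIntegral.integral_const_mul,
      ← intervalIntegral.integral_add_adjacent_intervals (hcont.intervalIntegrable _ 0)
        (hcont.intervalIntegrable _ _), hneg]
    unfold sqCdfSlope; ring

lemma sqCdf_nonneg (x : ℝ) : 0 ≤ sqCdf x := measureReal_nonneg

lemma sqCdf_mono : Monotone sqCdf := fun _ _ h =>
  measureReal_mono (fun _ hw => le_trans hw h)

/-- The distribution function of `χ²₁` is `1/2`-Hölder; no better exponent holds at `0`. -/
lemma sqCdf_sub_le {x y : ℝ} (h : x ≤ y) : sqCdf y - sqCdf x ≤ √(y - x) := by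
  have hcont : Continuous fun w : ℝ => Real.exp (-w ^ 2 / 2) := by fun_prop
  have hxy : √x ≤ √y := Real.sqrt_le_sqrt h
  have h1 : ∫ w in √x..√y, Real.exp (-w ^ 2 / 2) ≤ ∫ _w in √x..√y, (1 : ℝ) := by
    apply intervalIntegral.integral_mono_on hxy (hcont.intervalIntegrable _ _) (by simp)
    intro w _
    rw [Real.exp_le_one_iff]; nlinarith [sq_nonneg w]
  have h2 : √y ≤ √x + √(y - x) := by
    rcases le_total 0 x with hx | hx
    · apply Real.sqrt_le_iff.2 ⟨by positivity, ?_⟩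
      nlinarith [Real.sq_sqrt hx, Real.sq_sqrt (sub_nonneg.2 h), Real.sqrt_nonneg x,
        Real.sqrt_nonneg (y - x), mul_nonneg (Real.sqrt_nonneg x) (Real.sqrt_nonneg (y - x))]
    · rw [Real.sqrt_eq_zero_of_nonpos hx, zero_add]
      exact Real.sqrt_le_sqrt (by linarith)
  rw [sqCdf_eq_integral, sqCdf_eq_integral, ← mul_sub,
    intervalIntegral.integral_interval_sub_left (hcont.intervalIntegrable _ _)
      (hcont.intervalIntegrable _ _)]
  rw [intervalIntegral.integral_const, smul_eq_mul, mul_one] at h1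
  calc sqCdfSlope * ∫ w in √x..√y, Real.exp (-w ^ 2 / 2)
      ≤ sqCdfSlope * (√y - √x) := by gcongr; exact sqCdfSlope_pos.le
    _ ≤ 1 * (√y - √x) := by exact mul_le_mul_of_nonneg_right sqCdfSlope_le_one (sub_nonneg.2 hxy)
    _ ≤ √(y - x) := by linarith

lemma abs_sqCdf_sub_le (x y : ℝ) : |sqCdf x - sqCdf y| ≤ √|x - y| := by
  rcases le_total x y with h | h
  · rw [abs_sub_comm, abs_of_nonneg (sub_nonneg.2 (sqCdf_mono h)), abs_sub_comm,
      abs_of_nonneg (sub_nonneg.2 h)]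
    exact sqCdf_sub_le h
  · rw [abs_of_nonneg (sub_nonneg.2 (sqCdf_mono h)), abs_of_nonneg (sub_nonneg.2 h)]
    exact sqCdf_sub_le h

lemma sqCdf_le (x : ℝ) : sqCdf x ≤ sqCdfSlope * √x := by
  have hcont : Continuous fun w : ℝ => Real.exp (-w ^ 2 / 2) := by fun_prop
  rw [sqCdf_eq_integral]
  have h1 : ∫ w in (0 : ℝ)..√x, Real.exp (-w ^ 2 / 2) ≤ ∫ _w in (0 : ℝ)..√x, (1 : ℝ) := by
    apply intervalIntegral.integral_mono_on (Real.sqrt_nonneg x) (hcont.intervalIntegrable _ _)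
      (by simp)
    intro w _
    rw [Real.exp_le_one_iff]; nlinarith [sq_nonneg w]
  rw [intervalIntegral.integral_const, smul_eq_mul, mul_one, sub_zero] at h1
  exact mul_le_mul_of_nonneg_left h1 sqCdfSlope_pos.le

lemma le_sqCdf (x : ℝ) : sqCdfSlope * (√x * (1 - x / 2)) ≤ sqCdf x := by
  have hcont : Continuous fun w : ℝ => Real.exp (-w ^ 2 / 2) := by fun_prop
  rcases lt_or_ge x 0 with hx | hx
  · simpa [Real.sqrt_eq_zero_of_nonpos hx.le] using sqCdf_nonneg x
  rw [sqCdf_eq_integral]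
  have h1 : ∫ _w in (0 : ℝ)..√x, (1 - x / 2) ≤ ∫ w in (0 : ℝ)..√x, Real.exp (-w ^ 2 / 2) := by
    apply intervalIntegral.integral_mono_on (Real.sqrt_nonneg x) (by simp)
      (hcont.intervalIntegrable _ _)
    intro w hw
    have h2 : w ^ 2 ≤ x := by
      calc w ^ 2 ≤ √x ^ 2 := by gcongr; exacts [hw.1, hw.2]
        _ = x := Real.sq_sqrt hx
    linarith [Real.add_one_le_exp (-w ^ 2 / 2)]
  rw [intervalIntegral.integral_const, smul_eq_mul, sub_zero] at h1
  exact mul_le_mul_of_nonneg_left h1 sqCdfSlope_pos.le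

/-- The distribution function at `t` of `s Q + W ^ 2`, where `Q` has law `κ` and `W` is standard
normal, independent of `Q`. -/
noncomputable def shiftedCdf (κ : Measure ℝ) (s t : ℝ) : ℝ :=
  (κ.prod (gaussianReal 0 1)).real {p : ℝ × ℝ | s * p.1 + p.2 ^ 2 ≤ t}

lemma measurable_sqCdf : Measurable sqCdf := sqCdf_mono.measurable

lemma sqCdf_le_one (x : ℝ) : sqCdf x ≤ 1 := measureReal_le_one

lemma integrable_sqCdf_comp (κ : Measure ℝ) [IsProbabilityMeasure κ] (s t : ℝ) :
    Integrable (fun q => sqCdf (t - s * q)) κ := by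
  refine Integrable.of_bound (C := 1)
    (measurable_sqCdf.comp (by fun_prop)).aestronglyMeasurable (ae_of_all _ fun q => ?_)
  rw [Real.norm_of_nonneg (sqCdf_nonneg _)]
  exact sqCdf_le_one _

lemma shiftedCdf_eq_integral (κ : Measure ℝ) [IsProbabilityMeasure κ] (s t : ℝ) :
    shiftedCdf κ s t = ∫ q, sqCdf (t - s * q) ∂κ := by
  have hm : MeasurableSet {p : ℝ × ℝ | s * p.1 + p.2 ^ 2 ≤ t} :=
    measurableSet_le (by fun_prop) (by fun_prop)
  rw [shiftedCdf, Measure.real, Measure.prod_apply hm,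
    ← integral_toReal (measurable_measure_prodMk_left hm).aemeasurable
      (ae_of_all _ fun q => measure_lt_top _ _)]
  refine integral_congr_ae (ae_of_all _ fun q => ?_)
  simp only [sqCdf, Measure.real]
  congr 2
  ext w
  simp only [Set.mem_preimage, Set.mem_ofPred_eq]
  constructor <;> intro h <;> linarith

lemma sqrt_abs_le_one_add_sq (q : ℝ) : √|q| ≤ 1 + q ^ 2 := by
  apply Real.sqrt_le_iff.2 ⟨by positivity, ?_⟩
  nlinarith [sq_nonneg q, sq_abs q, sq_nonneg (|q| - 1), abs_nonneg q, sq_nonneg (q ^ 2)]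

/-- Since `sqCdf` is `1/2`-Hölder, a perturbation of size `s` with bounded variance changes it by
`O(√s)` uniformly. -/
lemma abs_shiftedCdf_sub_sqCdf_le (κ : Measure ℝ) [IsProbabilityMeasure κ] {s : ℝ} (hs : 0 ≤ s)
    (hi : Integrable (fun q : ℝ => q ^ 2) κ) (h2 : ∫ q, q ^ 2 ∂κ ≤ 1) (t : ℝ) :
    |shiftedCdf κ s t - sqCdf t| ≤ 2 * √s := by
  have hc : sqCdf t = ∫ _q, sqCdf t ∂κ := by simp
  rw [shiftedCdf_eq_integral, hc, ← integral_sub (integrable_sqCdf_comp κ s t) (by simp)]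
  calc |∫ q, (sqCdf (t - s * q) - sqCdf t) ∂κ| ≤ ∫ q, √s * (1 + q ^ 2) ∂κ := by
        rw [← Real.norm_eq_abs]
        refine norm_integral_le_of_norm_le (((integrable_const 1).add hi).const_mul _)
          (ae_of_all _ fun q => ?_)
        refine (abs_sqCdf_sub_le _ _).trans ?_
        rw [show t - s * q - t = -(s * q) by ring, abs_neg, abs_mul, abs_of_nonneg hs,
          Real.sqrt_mul hs]
        gcongr
        exact sqrt_abs_le_one_add_sq q
    _ = √s * (1 + ∫ q, q ^ 2 ∂κ) := by
        rw [integral_const_mul, integral_add (integrable_const 1) hi]; simp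
    _ ≤ 2 * √s := by nlinarith [Real.sqrt_nonneg s]

/-- An interval of length `l` carries at most `√l` of the mass of `s Q + W ^ 2`. -/
lemma shiftedCdf_sub_le (κ : Measure ℝ) [IsProbabilityMeasure κ] (s : ℝ) {t t' : ℝ}
    (h : t ≤ t') : shiftedCdf κ s t' - shiftedCdf κ s t ≤ √(t' - t) := by
  rw [shiftedCdf_eq_integral, shiftedCdf_eq_integral,
    ← integral_sub (integrable_sqCdf_comp κ s t') (integrable_sqCdf_comp κ s t)]
  calc ∫ q, (sqCdf (t' - s * q) - sqCdf (t - s * q)) ∂κ ≤ ∫ _q, √(t' - t) ∂κ := by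
        refine integral_mono ((integrable_sqCdf_comp κ s t').sub (integrable_sqCdf_comp κ s t))
          (by simp) fun q => ?_
        refine (sqCdf_sub_le (by linarith)).trans (Real.sqrt_le_sqrt (by linarith))
    _ = √(t' - t) := by simp

lemma integrable_sqrt_neg {κ : Measure ℝ} [IsProbabilityMeasure κ]
    (hi : Integrable (fun q : ℝ => q ^ 2) κ) : Integrable (fun q : ℝ => √(-q)) κ := by
  refine Integrable.mono' ((integrable_const 1).add hi)
    (by fun_prop) (ae_of_all _ fun q => ?_)
  rw [Real.norm_of_nonneg (Real.sqrt_nonneg _)]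
  exact (Real.sqrt_le_sqrt (neg_le_abs q)).trans (sqrt_abs_le_one_add_sq q)

/-- At `t = 0` only the negative part of `Q` contributes, through its half-order moment: the
junk value `√x = 0` for `x < 0` makes `√(-q)` the square root of the negative part of `q`. -/
lemma shiftedCdf_zero_le (κ : Measure ℝ) [IsProbabilityMeasure κ] {s : ℝ} (hs : 0 ≤ s)
    (hi : Integrable (fun q : ℝ => q ^ 2) κ) :
    shiftedCdf κ s 0 ≤ sqCdfSlope * √s * ∫ q, √(-q) ∂κ := by
  rw [shiftedCdf_eq_integral, ← integral_const_mul]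
  refine integral_mono (integrable_sqCdf_comp κ s 0) ((integrable_sqrt_neg hi).const_mul _)
    fun q => ?_
  refine (sqCdf_le _).trans (le_of_eq ?_)
  rw [show 0 - s * q = s * -q by ring, Real.sqrt_mul hs, mul_assoc]

lemma le_shiftedCdf_zero (κ : Measure ℝ) [IsProbabilityMeasure κ] {s : ℝ} (hs : 0 ≤ s)
    (hi : Integrable (fun q : ℝ => q ^ 2) κ) (h2 : ∫ q, q ^ 2 ∂κ ≤ 1) :
    sqCdfSlope * √s * (∫ q, √(-q) ∂κ - s) ≤ shiftedCdf κ s 0 := by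
  have hle : ∀ q : ℝ, sqCdfSlope * √s * (√(-q) - s * ((1 + q ^ 2) / 2))
      ≤ sqCdf (0 - s * q) := by
    intro q
    refine le_trans ?_ (le_sqCdf _)
    rw [show 0 - s * q = s * -q by ring, Real.sqrt_mul hs, mul_assoc, mul_assoc]
    refine mul_le_mul_of_nonneg_left ?_ sqCdfSlope_pos.le
    refine mul_le_mul_of_nonneg_left ?_ (Real.sqrt_nonneg s)
    rcases le_total 0 q with hq | hq
    · rw [Real.sqrt_eq_zero_of_nonpos (by linarith)]
      have : 0 ≤ s * ((1 + q ^ 2) / 2) := by positivity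
      linarith
    · have h3 : √(-q) * (-q) ≤ 1 + q ^ 2 := by
        have h0 := Real.sqrt_nonneg (-q)
        have h1 := Real.sq_sqrt (neg_nonneg.2 hq)
        set r := √(-q)
        have : q = - r ^ 2 := by linarith
        rw [this]
        nlinarith [sq_nonneg (r ^ 2 - 1), sq_nonneg (r - 1), sq_nonneg (r ^ 2 - r),
          mul_nonneg h0 (sq_nonneg (r - 1))]
      nlinarith
  rw [shiftedCdf_eq_integral]
  have hint : Integrable (fun q : ℝ => s * ((1 + q ^ 2) / 2)) κ :=
    ((((integrable_const 1).add hi).div_const 2).const_mul s)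
  calc sqCdfSlope * √s * (∫ q, √(-q) ∂κ - s)
      ≤ sqCdfSlope * √s * (∫ q, √(-q) ∂κ - s * ((1 + ∫ q, q ^ 2 ∂κ) / 2)) := by
        have := sqCdfSlope_pos
        gcongr
        nlinarith
    _ = ∫ q, sqCdfSlope * √s * (√(-q) - s * ((1 + q ^ 2) / 2)) ∂κ := by
        rw [integral_const_mul, integral_sub (integrable_sqrt_neg hi) hint, integral_const_mul,
          integral_div, integral_add (integrable_const 1) hi]
        simp
    _ ≤ _ := integral_mono (((integrable_sqrt_neg hi).sub hint).const_mul _)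
        (integrable_sqCdf_comp κ s 0) hle

/-! ### The law of the statistics -/

lemma isProbabilityMeasure_threePointLaw {ν s : ℝ} (hs : 0 ≤ s)
    (h : 3 * s ^ (2 * ν / (ν - 2)) ≤ 1) : IsProbabilityMeasure (threePointLaw ν s) := by
  have hp : 0 ≤ s ^ (2 * ν / (ν - 2)) := Real.rpow_nonneg hs _
  constructor
  simp only [threePointLaw, Measure.add_apply, Measure.smul_apply, measure_univ, smul_eq_mul,
    mul_one]
  rw [← ENNReal.ofReal_add (by positivity) (by linarith),
    ← ENNReal.ofReal_add (by linarith) hp, ← ENNReal.ofReal_one]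
  congr 1; ring

/-- The law of `n` independent copies of `(U_s, ξ₁, ξ₂)`, with the coordinates regrouped into the
samples of `(U_s, ξ₁)` and of `ξ₂`. -/
noncomputable def sampleLaw (ν s : ℝ) (n : ℕ) :
    Measure (((Fin n → ℝ) × (Fin n → ℝ)) × (Fin n → ℝ)) :=
  ((Measure.pi fun _ : Fin n => threePointLaw ν s).prod
    (Measure.pi fun _ : Fin n => gaussianReal 0 1)).prod
      (Measure.pi fun _ : Fin n => gaussianReal 0 1)

/-- The law of `Q = (S + G) / √2`, where `S = (∑ U_i) / (√n s)` is the standardised sum of `n`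
independent copies of `U_s` and `G` is an independent standard normal variable. -/
noncomputable def mixLaw (ν s : ℝ) (n : ℕ) : Measure ℝ :=
  ((Measure.pi fun _ : Fin n => threePointLaw ν s).prod (gaussianReal 0 1)).map
    fun p => ((∑ i, p.1 i) / (√n * s) + p.2) / √2

lemma isProbabilityMeasure_mixLaw {ν s : ℝ} (n : ℕ) [IsProbabilityMeasure (threePointLaw ν s)] :
    IsProbabilityMeasure (mixLaw ν s n) :=
  Measure.isProbabilityMeasure_map (by fun_prop)

lemma pi_gaussianReal_map_sum_div_sqrt {n : ℕ} (hn : 0 < n) :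
    (Measure.pi fun _ : Fin n => gaussianReal 0 1).map (fun z => (∑ i, z i) / √n)
      = gaussianReal 0 1 := by
  set P := Measure.pi fun _ : Fin n => gaussianReal 0 1
  have hG : ∀ i : Fin n, HasGaussianLaw (fun z : Fin n → ℝ => z i) P := fun i => by
    constructor
    rw [(measurePreserving_eval (fun _ : Fin n => gaussianReal 0 1) i).map_eq]
    infer_instance
  have hind : iIndepFun (fun (i : Fin n) (z : Fin n → ℝ) => z i) P :=
    iIndepFun_pi (X := fun _ => id) fun i => aemeasurable_id
  have hsum := iIndepFun.hasGaussianLaw_fun_sum hG hind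
  have hmean : ∫ z, ∑ i, z i ∂P = 0 := by
    rw [integral_finsetSum _ fun i _ => (hG i).integrable]
    refine Finset.sum_eq_zero fun i _ => ?_
    have := integral_comp_eval (μ := fun _ : Fin n => gaussianReal 0 1) (i := i)
      (f := fun x : ℝ => x) (by fun_prop)
    rw [this, integral_id_gaussianReal]
  have hvar : Var[fun z : Fin n → ℝ => ∑ i, z i; P] = n := by
    have := variance_sum_pi (μ := fun _ : Fin n => gaussianReal 0 1) (X := fun _ x => x)
      fun i => memLp_id_gaussianReal' 2 (by simp)
    simp only [variance_fun_id_gaussianReal] at this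
    rw [show (fun z : Fin n → ℝ => ∑ i, z i) = ∑ i, fun z : Fin n → ℝ => z i by ext; simp, this]
    simp
  have h1 := hsum.map_eq_gaussianReal
  rw [hmean, hvar] at h1
  have h2 : P.map (fun z => (∑ i, z i) / √n)
      = (P.map (fun z => ∑ i, z i)).map (fun x => x / √n) := by
    rw [Measure.map_map (by fun_prop) (by fun_prop)]; rfl
  rw [h2, h1, gaussianReal_map_div_const]
  congr 1
  · simp
  · ext
    have : (0 : ℝ) < n := by exact_mod_cast hn
    simp [Real.sq_sqrt this.le, this.ne']

/-- The standardised linear part `Q` and the normalised sum `W` of the `ξ₂`-sample are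
independent. -/
lemma sampleLaw_map_eq_prod {ν s : ℝ} {n : ℕ} (hn : 0 < n)
    [IsProbabilityMeasure (threePointLaw ν s)] :
    (sampleLaw ν s n).map (fun ω =>
        (((∑ i, ω.1.1 i) / (√n * s) + (∑ i, ω.1.2 i) / √n) / √2, (∑ i, ω.2 i) / √n))
      = (mixLaw ν s n).prod (gaussianReal 0 1) := by
  have h1 : ((Measure.pi fun _ : Fin n => threePointLaw ν s).prod
      (Measure.pi fun _ : Fin n => gaussianReal 0 1)).map
        (fun p => ((∑ i, p.1 i) / (√n * s) + (∑ i, p.2 i) / √n) / √2) = mixLaw ν s n := by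
    rw [mixLaw]
    nth_rewrite 2 [← pi_gaussianReal_map_sum_div_sqrt hn]
    nth_rewrite 2 [← Measure.map_id (μ := Measure.pi fun _ : Fin n => threePointLaw ν s)]
    rw [Measure.map_prod_map _ _ (by fun_prop) (by fun_prop),
      Measure.map_map (by fun_prop) (by fun_prop)]
    rfl
  nth_rewrite 1 [← pi_gaussianReal_map_sum_div_sqrt hn]
  rw [← h1, Measure.map_prod_map _ _ (by fun_prop) (by fun_prop)]
  rfl

lemma pi_planeLaw_eq_map {ν s : ℝ} (n : ℕ) [IsProbabilityMeasure (threePointLaw ν s)] :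
    (Measure.pi fun _ : Fin n => planeLaw ν s) = (sampleLaw ν s n).map
      (fun ω i => (ω.1.1 i / √2 + s / √2 * ω.1.2 i, ω.2 i)) := by
  have hA := measurePreserving_arrowProdEquivProdArrow ℝ (ℝ × ℝ) (Fin n)
    (fun _ => threePointLaw ν s) (fun _ => (gaussianReal 0 1).prod (gaussianReal 0 1))
  have hB := measurePreserving_arrowProdEquivProdArrow ℝ ℝ (Fin n)
    (fun _ => gaussianReal 0 1) (fun _ => gaussianReal 0 1)
  have hC := ((measurePreserving_prodAssoc (Measure.pi fun _ : Fin n => threePointLaw ν s)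
    (Measure.pi fun _ : Fin n => gaussianReal 0 1)
    (Measure.pi fun _ : Fin n => gaussianReal 0 1)).symm).comp
      (((MeasurePreserving.id (Measure.pi fun _ : Fin n => threePointLaw ν s)).prod hB).comp hA)
  rw [sampleLaw, ← hC.map_eq, Measure.map_map (by fun_prop) hC.measurable]
  have : IsProbabilityMeasure (planeLaw ν s) := Measure.isProbabilityMeasure_map (by fun_prop)
  simp only [planeLaw] at this ⊢
  rw [← Measure.pi_map_pi (fun _ => by fun_prop)]
  rfl

/-- The V-statistic of the planar kernel splits into a linear part in the first coordinates and
the square of the normalised sum of the second ones. -/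
lemma mul_vStat_planeKernelV {n : ℕ} (hn : 0 < n) (y : Fin n → ℝ × ℝ) :
    n * vStat (planeKernelV n) y
      = (∑ i, (y i).1) / √n + ((∑ i, (y i).2) / √n) ^ 2 := by
  have h0 : (0 : ℝ) < n := by exact_mod_cast hn
  have h1 : √(n : ℝ) ^ 2 = n := Real.sq_sqrt h0.le
  have h2 : 0 < √(n : ℝ) := Real.sqrt_pos.2 h0
  simp only [vStat, planeKernelV, Finset.sum_add_distrib, ← Finset.mul_sum, ← Finset.sum_mul,
    ← Finset.sum_div, Finset.sum_const, Finset.card_univ, Fintype.card_fin, nsmul_eq_mul]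
  rw [div_pow, h1]
  field_simp
  ring

/-- The diagonal terms missing from the U-statistic turn the `χ²₁` part into its centred version,
up to the fluctuation of the empirical second moment. -/
lemma mul_uStat_planeKernelU {n : ℕ} (hn : 1 < n) (y : Fin n → ℝ × ℝ) :
    √(n * (n - 1)) * uStat (planeKernelU n) y
      = (∑ i, (y i).1) / √n + ((∑ i, (y i).2) / √n) ^ 2 - (∑ i, (y i).2 ^ 2) / n := by
  have h0 : (1 : ℝ) < n := by exact_mod_cast hn
  have h00 : (0 : ℝ) < n := by linarith
  have h01 : (0 : ℝ) < n - 1 := by linarith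
  have h1 : √(n : ℝ) ^ 2 = n := Real.sq_sqrt h00.le
  have h2 : 0 < √(n : ℝ) := Real.sqrt_pos.2 h00
  have h3 : √((n : ℝ) - 1) ^ 2 = n - 1 := Real.sq_sqrt h01.le
  have h4 : 0 < √((n : ℝ) - 1) := Real.sqrt_pos.2 h01
  have hif : ∀ i j : Fin n, (if i ≠ j then planeKernelU n (y i) (y j) else 0)
      = planeKernelU n (y i) (y j) - if i = j then planeKernelU n (y i) (y i) else 0 := by
    intro i j
    by_cases h : i = j
    · subst h; simp
    · simp [h]
  simp only [uStat, hif, Finset.sum_sub_distrib, Finset.sum_ite_eq, Finset.mem_univ, if_true]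
  simp only [planeKernelU, Finset.sum_add_distrib, ← Finset.mul_sum, ← Finset.sum_mul,
    ← Finset.sum_div, Finset.sum_const, Finset.card_univ, Fintype.card_fin, nsmul_eq_mul]
  rw [Real.sqrt_mul h00.le, div_pow, h1]
  simp only [← pow_two]
  set a := √(n : ℝ)
  set b := √((n : ℝ) - 1)
  have e1 : (n : ℝ) = a ^ 2 := h1.symm
  have e2 : a ^ 2 - 1 = b ^ 2 := by rw [h3, h1]
  rw [e1, e2]
  field_simp
  rw [← e2]
  ring

lemma measurable_vStat_planeKernelV (n : ℕ) :
    Measurable fun y : Fin n → ℝ × ℝ => vStat (planeKernelV n) y := by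
  unfold vStat planeKernelV
  fun_prop

lemma measurable_uStat_planeKernelU (n : ℕ) :
    Measurable fun y : Fin n → ℝ × ℝ => uStat (planeKernelU n) y := by
  unfold uStat
  refine Measurable.div_const (Finset.measurable_sum _ fun i _ => Finset.measurable_sum _
    fun j _ => ?_) _
  split_ifs
  · unfold planeKernelU; fun_prop
  · exact measurable_const

/-- The law of a statistic of the sample `φ X₁, …, φ X_n` does not depend on the realization. -/
lemma IsRealization.pi_real_le {ν s : ℝ} {n d : ℕ} {μ : Measure (EuclideanSpace ℝ (Fin d))}
    {φ : EuclideanSpace ℝ (Fin d) → ℝ × ℝ} (h : IsRealization ν s μ φ)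
    [IsProbabilityMeasure (threePointLaw ν s)] {F : (Fin n → ℝ × ℝ) → ℝ} (hF : Measurable F)
    (t : ℝ) :
    (Measure.pi fun _ : Fin n => μ).real {x | F (fun i => φ (x i)) ≤ t} =
      (sampleLaw ν s n).real
        {ω | F (fun i => (ω.1.1 i / √2 + s / √2 * ω.1.2 i, ω.2 i)) ≤ t} := by
  have := h.isProb
  have hφ := h.measurable
  have hpl : IsProbabilityMeasure (planeLaw ν s) := Measure.isProbabilityMeasure_map (by fun_prop)
  have : ∀ _i : Fin n, SigmaFinite (μ.map φ) := fun _ => by rw [h.map_eq]; infer_instance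
  have h1 : (Measure.pi fun _ : Fin n => μ).map (fun x i => φ (x i))
      = (sampleLaw ν s n).map (fun ω i => (ω.1.1 i / √2 + s / √2 * ω.1.2 i, ω.2 i)) := by
    rw [← pi_planeLaw_eq_map, Measure.pi_map_pi (fun _ => hφ.aemeasurable), h.map_eq]
  have hm : MeasurableSet {y | F y ≤ t} := measurableSet_le hF measurable_const
  have h2 := congrArg (fun m => m.real {y | F y ≤ t}) h1
  rwa [map_measureReal_apply (by fun_prop) hm, map_measureReal_apply (by fun_prop) hm] at h2

lemma sampleLaw_real_le {ν s : ℝ} {n : ℕ} (hn : 0 < n)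
    [IsProbabilityMeasure (threePointLaw ν s)] (t : ℝ) :
    (sampleLaw ν s n).real {ω | s * (((∑ i, ω.1.1 i) / (√n * s) + (∑ i, ω.1.2 i) / √n) / √2)
      + ((∑ i, ω.2 i) / √n) ^ 2 ≤ t} = shiftedCdf (mixLaw ν s n) s t := by
  rw [shiftedCdf, ← sampleLaw_map_eq_prod hn, map_measureReal_apply (by fun_prop)
    (measurableSet_le (by fun_prop) (by fun_prop))]
  rfl

lemma linear_part_eq {s : ℝ} (hs : 0 < s) {n : ℕ} (hn : 0 < n) (u g : Fin n → ℝ) :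
    (∑ i, (u i / √2 + s / √2 * g i)) / √n
      = s * (((∑ i, u i) / (√n * s) + (∑ i, g i) / √n) / √2) := by
  have h0 : 0 < √(n : ℝ) := Real.sqrt_pos.2 (by exact_mod_cast hn)
  rw [Finset.sum_add_distrib, ← Finset.mul_sum, ← Finset.sum_div]
  field_simp

lemma IsRealization.pi_real_vStat_le {ν s : ℝ} (hs : 0 < s) {n d : ℕ} (hn : 0 < n)
    {μ : Measure (EuclideanSpace ℝ (Fin d))} {φ : EuclideanSpace ℝ (Fin d) → ℝ × ℝ}
    (h : IsRealization ν s μ φ) [IsProbabilityMeasure (threePointLaw ν s)] (t : ℝ) :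
    (Measure.pi fun _ : Fin n => μ).real {x | n * vStat (kernelV n φ) x ≤ t}
      = shiftedCdf (mixLaw ν s n) s t := by
  rw [← sampleLaw_real_le hn]
  have := h.pi_real_le (n := n) ((measurable_vStat_planeKernelV n).const_mul (n : ℝ)) t
  simp only [mul_vStat_planeKernelV hn, linear_part_eq hs hn] at this
  rw [← this]
  congr 1
  ext x
  have := mul_vStat_planeKernelV hn (fun i => φ (x i))
  simp only [Set.mem_ofPred_eq]
  rw [← this]
  rfl

/-- Replacing `X` by `Y` changes the distribution function at `t` by no more than the probability
of `δ ≤ |Y - X|` plus the mass of `X` near `t`. -/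
lemma abs_real_le_sub_real_le {Ω : Type*} [MeasurableSpace Ω] (P : Measure Ω)
    [IsProbabilityMeasure P] (X Y : Ω → ℝ) {δ : ℝ} (hδ : 0 ≤ δ) (t : ℝ) :
    |P.real {ω | Y ω ≤ t} - P.real {ω | X ω ≤ t}| ≤
      P.real {ω | δ ≤ |Y ω - X ω|} + (P.real {ω | X ω ≤ t + δ} - P.real {ω | X ω ≤ t - δ}) := by
  have h1 : P.real {ω | Y ω ≤ t} ≤ P.real {ω | X ω ≤ t + δ} + P.real {ω | δ ≤ |Y ω - X ω|} := by
    refine (measureReal_mono fun ω hω => ?_).trans (measureReal_union_le _ _)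
    by_cases h : δ ≤ |Y ω - X ω|
    · exact Or.inr h
    · left
      simp only [Set.mem_ofPred_eq, not_le] at *
      linarith [neg_abs_le (Y ω - X ω)]
  have h2 : P.real {ω | X ω ≤ t - δ} ≤ P.real {ω | Y ω ≤ t} + P.real {ω | δ ≤ |Y ω - X ω|} := by
    refine (measureReal_mono fun ω hω => ?_).trans (measureReal_union_le _ _)
    by_cases h : δ ≤ |Y ω - X ω|
    · exact Or.inr h
    · left
      simp only [Set.mem_ofPred_eq, not_le] at *
      linarith [le_abs_self (Y ω - X ω)]
  have h3 : P.real {ω | X ω ≤ t} ≤ P.real {ω | X ω ≤ t + δ} :=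
    measureReal_mono fun ω (hω : X ω ≤ t) => show X ω ≤ t + δ by linarith
  have h4 : P.real {ω | X ω ≤ t - δ} ≤ P.real {ω | X ω ≤ t} :=
    measureReal_mono fun ω (hω : X ω ≤ t - δ) => show X ω ≤ t by linarith
  rw [abs_le]; constructor <;> linarith

lemma memLp_sq_gaussianReal : MemLp (fun z : ℝ => z ^ 2) 2 (gaussianReal 0 1) := by
  rw [memLp_two_iff_integrable_sq (by fun_prop)]
  have := (memLp_id_gaussianReal' (μ := 0) (v := 1) 4 (by simp)).integrable_norm_pow (by norm_num)
  refine this.congr (ae_of_all _ fun z => ?_)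
  simp only [id, Real.norm_eq_abs]
  rw [← pow_mul, Even.pow_abs (by decide)]

lemma integral_sq_gaussianReal : ∫ z, z ^ 2 ∂(gaussianReal 0 1) = 1 := by
  have := variance_fun_id_gaussianReal (μ := 0) (v := 1)
  rw [variance_of_integral_eq_zero (by fun_prop) (by simp)] at this
  simpa using this

/-- Chebyshev's inequality for the empirical second moment of a normal sample. -/
lemma pi_gaussianReal_empirical_sq_le {n : ℕ} (hn : 0 < n) {δ : ℝ} (hδ : 0 < δ) :
    (Measure.pi fun _ : Fin n => gaussianReal 0 1).real {z | δ ≤ |(∑ i, z i ^ 2) / n - 1|}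
      ≤ Var[fun z => z ^ 2; gaussianReal 0 1] / (n * δ ^ 2) := by
  set P := Measure.pi fun _ : Fin n => gaussianReal 0 1
  have h0 : (0 : ℝ) < n := by exact_mod_cast hn
  have hL : ∀ i : Fin n, MemLp (fun z : Fin n → ℝ => z i ^ 2) 2 P := fun i =>
    memLp_sq_gaussianReal.comp_measurePreserving
      (measurePreserving_eval (fun _ : Fin n => gaussianReal 0 1) i)
  have hS : MemLp (fun z : Fin n → ℝ => ∑ i, z i ^ 2) 2 P :=
    memLp_finsetSum _ fun i _ => hL i
  have hmean : ∫ z, ∑ i, z i ^ 2 ∂P = (n : ℝ) := by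
    rw [integral_finsetSum _ fun i _ => (hL i).integrable (by norm_num)]
    have : ∀ i : Fin n, ∫ z, z i ^ 2 ∂P = 1 := fun i => by
      have := integral_comp_eval (μ := fun _ : Fin n => gaussianReal 0 1) (i := i)
        (f := fun x : ℝ => x ^ 2) (by fun_prop)
      rw [this, integral_sq_gaussianReal]
    simp [this]
  have hvar : Var[fun z : Fin n → ℝ => ∑ i, z i ^ 2; P]
      = n * Var[fun z => z ^ 2; gaussianReal 0 1] := by
    have := variance_sum_pi (μ := fun _ : Fin n => gaussianReal 0 1) (X := fun _ x => x ^ 2)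
      fun i => memLp_sq_gaussianReal
    rw [show (fun z : Fin n → ℝ => ∑ i, z i ^ 2) = ∑ i, fun z : Fin n → ℝ => z i ^ 2 by ext; simp,
      this]
    simp
  have hC := meas_ge_le_variance_div_sq hS (c := n * δ) (by positivity)
  rw [hmean, hvar] at hC
  have hset : {z : Fin n → ℝ | δ ≤ |(∑ i, z i ^ 2) / n - 1|}
      = {z | n * δ ≤ |∑ i, z i ^ 2 - (n : ℝ)|} := by
    ext z
    simp only [Set.mem_ofPred_eq]
    rw [show (∑ i, z i ^ 2) / (n : ℝ) - 1 = (∑ i, z i ^ 2 - (n : ℝ)) / n by field_simp, abs_div,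
      abs_of_pos h0, le_div_iff₀ h0, mul_comm]
  rw [hset]
  refine (ENNReal.toReal_le_of_le_ofReal ?_ hC).trans (le_of_eq ?_)
  · have := variance_nonneg (fun z : ℝ => z ^ 2) (gaussianReal 0 1)
    positivity
  · field_simp

lemma IsRealization.abs_pi_real_uStat_le_sub {ν s : ℝ} (hs : 0 < s) {n d : ℕ} (hn : 1 < n)
    {μ : Measure (EuclideanSpace ℝ (Fin d))} {φ : EuclideanSpace ℝ (Fin d) → ℝ × ℝ}
    (h : IsRealization ν s μ φ) [IsProbabilityMeasure (threePointLaw ν s)] {δ : ℝ} (hδ : 0 < δ)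
    (t : ℝ) :
    |(Measure.pi fun _ : Fin n => μ).real {x | √(n * (n - 1)) * uStat (kernelU n φ) x ≤ t}
      - shiftedCdf (mixLaw ν s n) s (t + 1)|
      ≤ Var[fun z => z ^ 2; gaussianReal 0 1] / (n * δ ^ 2) + √(2 * δ) := by
  have hn0 : 0 < n := by omega
  have hprob : IsProbabilityMeasure (sampleLaw ν s n) := by unfold sampleLaw; infer_instance
  have := isProbabilityMeasure_mixLaw (ν := ν) (s := s) n
  have hU := h.pi_real_le (n := n)
    ((measurable_uStat_planeKernelU n).const_mul √((n : ℝ) * (n - 1))) t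
  have hset : {x : Fin n → EuclideanSpace ℝ (Fin d) | √((n : ℝ) * (n - 1)) *
      uStat (kernelU n φ) x ≤ t} = {x | √((n : ℝ) * (n - 1)) *
      uStat (planeKernelU n) (fun i => φ (x i)) ≤ t} := rfl
  rw [hset, hU]
  simp only [mul_uStat_planeKernelU hn, linear_part_eq hs hn0]
  set X : ((Fin n → ℝ) × (Fin n → ℝ)) × (Fin n → ℝ) → ℝ := fun ω =>
    s * (((∑ i, ω.1.1 i) / (√n * s) + (∑ i, ω.1.2 i) / √n) / √2) + ((∑ i, ω.2 i) / √n) ^ 2 with hX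
  have hcdf : ∀ t, (sampleLaw ν s n).real {ω | X ω ≤ t} = shiftedCdf (mixLaw ν s n) s t :=
    fun t => sampleLaw_real_le hn0 t
  have hY : {ω : ((Fin n → ℝ) × (Fin n → ℝ)) × (Fin n → ℝ) |
      X ω - (∑ i, ω.2 i ^ 2) / n ≤ t} = {ω | X ω - ((∑ i, ω.2 i ^ 2) / n - 1) ≤ t + 1} := by
    ext ω; simp only [Set.mem_ofPred_eq]; constructor <;> intro h <;> linarith
  rw [hY, ← hcdf]
  refine (abs_real_le_sub_real_le (sampleLaw ν s n) X _ hδ.le (t + 1)).trans (add_le_add ?_ ?_)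
  · have hm : MeasurableSet {z : Fin n → ℝ | δ ≤ |(∑ i, z i ^ 2) / n - 1|} :=
      measurableSet_le measurable_const
        (Measurable.comp (g := fun x : ℝ => |x|) (by fun_prop) (by fun_prop))
    have h2 : (sampleLaw ν s n).real
        {ω | δ ≤ |X ω - ((∑ i, ω.2 i ^ 2) / n - 1) - X ω|} =
        (Measure.pi fun _ : Fin n => gaussianReal 0 1).real
          {z | δ ≤ |(∑ i, z i ^ 2) / n - 1|} := by
      have h3 : (sampleLaw ν s n).map Prod.snd = Measure.pi fun _ : Fin n => gaussianReal 0 1 := by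
        rw [sampleLaw]; exact measurePreserving_snd.map_eq
      rw [← h3, map_measureReal_apply measurable_snd hm]
      congr 1
      ext ω
      simp only [Set.mem_ofPred_eq, Set.mem_preimage, sub_sub_cancel_left, abs_neg]
    rw [h2]
    exact pi_gaussianReal_empirical_sq_le hn0 hδ
  · rw [hcdf, hcdf]
    refine (shiftedCdf_sub_le _ s (by linarith)).trans (Real.sqrt_le_sqrt (by linarith))

/-! ### Moments of the standardised linear part -/

lemma integrable_threePointLaw {ν s : ℝ} (f : ℝ → ℝ) : Integrable f (threePointLaw ν s) := by
  refine ((Integrable.smul_measure ?_ ENNReal.ofReal_ne_top).add_measure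
    (Integrable.smul_measure ?_ ENNReal.ofReal_ne_top)).add_measure
    (Integrable.smul_measure ?_ ENNReal.ofReal_ne_top) <;> exact integrable_dirac (by simp)

lemma integral_threePointLaw {ν s : ℝ} (hs : 0 ≤ s) (h : 3 * s ^ (2 * ν / (ν - 2)) ≤ 1)
    (f : ℝ → ℝ) :
    ∫ u, f u ∂(threePointLaw ν s) =
      2 * s ^ (2 * ν / (ν - 2)) * f (-((√6)⁻¹ * s ^ (-2 / (ν - 2))))
        + (1 - 3 * s ^ (2 * ν / (ν - 2))) * f 0
        + s ^ (2 * ν / (ν - 2)) * f (2 * (√6)⁻¹ * s ^ (-2 / (ν - 2))) := by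
  have hp : 0 ≤ s ^ (2 * ν / (ν - 2)) := Real.rpow_nonneg hs _
  have hi : ∀ (c : ℝ) (x : ℝ), Integrable f (ENNReal.ofReal c • Measure.dirac x) := fun c x =>
    Integrable.smul_measure (integrable_dirac (by simp)) ENNReal.ofReal_ne_top
  rw [threePointLaw, integral_add_measure ((hi _ _).add_measure (hi _ _)) (hi _ _),
    integral_add_measure (hi _ _) (hi _ _)]
  simp only [integral_smul_measure, integral_dirac, smul_eq_mul]
  rw [ENNReal.toReal_ofReal (by positivity), ENNReal.toReal_ofReal (by linarith),
    ENNReal.toReal_ofReal hp]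

lemma integral_id_threePointLaw {ν s : ℝ} (hs : 0 ≤ s) (h : 3 * s ^ (2 * ν / (ν - 2)) ≤ 1) :
    ∫ u, u ∂(threePointLaw ν s) = 0 := by
  rw [integral_threePointLaw hs h fun u => u]; ring

lemma integral_sq_threePointLaw {ν s : ℝ} (hν : 2 < ν) (hs : 0 < s)
    (h : 3 * s ^ (2 * ν / (ν - 2)) ≤ 1) : ∫ u, u ^ 2 ∂(threePointLaw ν s) = s ^ 2 := by
  have h6 : √(6 : ℝ) ^ 2 = 6 := Real.sq_sqrt (by norm_num)
  have hpow : s ^ (2 * ν / (ν - 2)) * (s ^ (-2 / (ν - 2))) ^ 2 = s ^ 2 := by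
    have : ν - 2 ≠ 0 := by linarith
    rw [← Real.rpow_natCast, ← Real.rpow_mul hs.le, ← Real.rpow_add hs, ← Real.rpow_natCast]
    congr 1; push_cast; field_simp; ring
  rw [integral_threePointLaw hs.le h fun u => u ^ 2]
  simp only [neg_sq, mul_pow, inv_pow, h6]
  linear_combination hpow

lemma threePointLaw_real_ne_zero_le {ν s : ℝ} (hs : 0 ≤ s)
    (h : 3 * s ^ (2 * ν / (ν - 2)) ≤ 1) :
    (threePointLaw ν s).real {u | u ≠ 0} ≤ 3 * s ^ (2 * ν / (ν - 2)) := by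
  have hp : 0 ≤ s ^ (2 * ν / (ν - 2)) := Real.rpow_nonneg hs _
  have hm : MeasurableSet {u : ℝ | u ≠ 0} := (measurableSet_singleton (0 : ℝ)).compl
  have := isProbabilityMeasure_threePointLaw hs h
  rw [← integral_indicator_one hm, integral_threePointLaw hs h]
  have h1 : ∀ x : ℝ, Set.indicator {u : ℝ | u ≠ 0} (1 : ℝ → ℝ) x ≤ 1 := fun x =>
    Set.indicator_le_self' (fun _ _ => zero_le_one) x
  have h0 : Set.indicator {u : ℝ | u ≠ 0} (1 : ℝ → ℝ) 0 = 0 := by simp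
  rw [h0]
  nlinarith [mul_le_mul_of_nonneg_left (h1 (-((√6)⁻¹ * s ^ (-2 / (ν - 2))))) hp,
    mul_le_mul_of_nonneg_left (h1 (2 * (√6)⁻¹ * s ^ (-2 / (ν - 2)))) hp]

lemma memLp_threePointLaw {ν s : ℝ} : MemLp (fun u => u) 2 (threePointLaw ν s) := by
  rw [memLp_two_iff_integrable_sq (by fun_prop)]
  exact integrable_threePointLaw _

section MixLaw

variable {ν s : ℝ} {n : ℕ}

lemma memLp_standardised_sum [IsProbabilityMeasure (threePointLaw ν s)] :
    MemLp (fun u : Fin n → ℝ => (∑ i, u i) / (√n * s)) 2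
      (Measure.pi fun _ : Fin n => threePointLaw ν s) := by
  simp only [div_eq_inv_mul]
  exact (memLp_finsetSum _ fun i _ => memLp_threePointLaw.comp_measurePreserving
    (measurePreserving_eval (fun _ : Fin n => threePointLaw ν s) i)).const_mul _

lemma integral_standardised_sum (hs : 0 ≤ s) (h : 3 * s ^ (2 * ν / (ν - 2)) ≤ 1) :
    ∫ u : Fin n → ℝ, (∑ i, u i) / (√n * s) ∂(Measure.pi fun _ : Fin n => threePointLaw ν s)
      = 0 := by
  have := isProbabilityMeasure_threePointLaw hs h
  have hi : ∀ i : Fin n, Integrable (fun u : Fin n → ℝ => u i)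
      (Measure.pi fun _ : Fin n => threePointLaw ν s) := fun i =>
    (memLp_threePointLaw.comp_measurePreserving
      (measurePreserving_eval (fun _ : Fin n => threePointLaw ν s) i)).integrable (by norm_num)
  have h1 : ∀ i : Fin n, ∫ u : Fin n → ℝ, u i
      ∂(Measure.pi fun _ : Fin n => threePointLaw ν s) = 0 := fun i => by
    have := integral_comp_eval (μ := fun _ : Fin n => threePointLaw ν s) (i := i)
      (f := fun x : ℝ => x) (by fun_prop)
    rw [this, integral_id_threePointLaw hs h]
  rw [integral_div, integral_finsetSum _ fun i _ => hi i]
  simp [h1]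

lemma integral_standardised_sum_sq (hν : 2 < ν) (hs : 0 < s)
    (h : 3 * s ^ (2 * ν / (ν - 2)) ≤ 1) (hn : 0 < n) :
    ∫ u : Fin n → ℝ, ((∑ i, u i) / (√n * s)) ^ 2
      ∂(Measure.pi fun _ : Fin n => threePointLaw ν s) = 1 := by
  have := isProbabilityMeasure_threePointLaw hs.le h
  have hn' : (0 : ℝ) < n := by exact_mod_cast hn
  have hvar : Var[fun u => u; threePointLaw ν s] = s ^ 2 := by
    rw [variance_of_integral_eq_zero (by fun_prop) (integral_id_threePointLaw hs.le h)]
    exact integral_sq_threePointLaw hν hs h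
  have h1 : Var[fun u : Fin n → ℝ => (∑ i, u i) / (√n * s);
      Measure.pi fun _ : Fin n => threePointLaw ν s] = 1 := by
    have h2 := variance_sum_pi (μ := fun _ : Fin n => threePointLaw ν s) (X := fun _ x => x)
      fun i => memLp_threePointLaw
    simp only [hvar] at h2
    simp only [div_eq_inv_mul]
    rw [variance_const_mul,
      show (fun u : Fin n → ℝ => ∑ i, u i) = ∑ i, fun u : Fin n → ℝ => u i by ext; simp, h2]
    simp only [Finset.sum_const, Finset.card_univ, Fintype.card_fin, nsmul_eq_mul, inv_pow,
      mul_pow, Real.sq_sqrt hn'.le]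
    field_simp
  rw [variance_of_integral_eq_zero (by fun_prop) (integral_standardised_sum hs.le h)] at h1
  exact h1

lemma integrable_sq_add_div [IsProbabilityMeasure (threePointLaw ν s)] :
    Integrable (fun p : (Fin n → ℝ) × ℝ => (((∑ i, p.1 i) / (√n * s) + p.2) / √2) ^ 2)
      ((Measure.pi fun _ : Fin n => threePointLaw ν s).prod (gaussianReal 0 1)) := by
  rw [← memLp_two_iff_integrable_sq (by fun_prop)]
  simp only [div_eq_inv_mul _ (√2)]
  exact ((memLp_standardised_sum.comp_measurePreserving measurePreserving_fst).add
    ((memLp_id_gaussianReal' 2 (by simp)).comp_measurePreserving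
      measurePreserving_snd)).const_mul _

lemma integrable_sq_mixLaw [IsProbabilityMeasure (threePointLaw ν s)] :
    Integrable (fun q : ℝ => q ^ 2) (mixLaw ν s n) := by
  rw [mixLaw, integrable_map_measure (by fun_prop) (by fun_prop)]
  exact integrable_sq_add_div

lemma integral_sq_mixLaw (hν : 2 < ν) (hs : 0 < s) (h : 3 * s ^ (2 * ν / (ν - 2)) ≤ 1)
    (hn : 0 < n) : ∫ q, q ^ 2 ∂(mixLaw ν s n) = 1 := by
  have := isProbabilityMeasure_threePointLaw hs.le h
  have hS := memLp_standardised_sum (ν := ν) (s := s) (n := n)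
  have hG : MemLp (fun x : ℝ => x) 2 (gaussianReal 0 1) := memLp_id_gaussianReal' 2 (by simp)
  rw [mixLaw, integral_map (by fun_prop) (by fun_prop)]
  set P := Measure.pi fun _ : Fin n => threePointLaw ν s
  have hexp : ∀ p : (Fin n → ℝ) × ℝ, (((∑ i, p.1 i) / (√n * s) + p.2) / √2) ^ 2
      = 2⁻¹ * ((∑ i, p.1 i) / (√n * s)) ^ 2 + (∑ i, p.1 i) / (√n * s) * p.2
        + 2⁻¹ * p.2 ^ 2 := fun p => by
    rw [div_pow, Real.sq_sqrt (by norm_num)]; ring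
  simp only [hexp]
  have i1 : Integrable (fun p : (Fin n → ℝ) × ℝ => 2⁻¹ * ((∑ i, p.1 i) / (√n * s)) ^ 2)
      (P.prod (gaussianReal 0 1)) := (hS.integrable_sq.comp_fst _).const_mul _
  have i2 : Integrable (fun p : (Fin n → ℝ) × ℝ => (∑ i, p.1 i) / (√n * s) * p.2)
      (P.prod (gaussianReal 0 1)) :=
    (hS.integrable (by norm_num)).mul_prod (hG.integrable (by norm_num))
  have i3 : Integrable (fun p : (Fin n → ℝ) × ℝ => 2⁻¹ * p.2 ^ 2)
      (P.prod (gaussianReal 0 1)) := (hG.integrable_sq.comp_snd _).const_mul _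
  have i12 : Integrable (fun p : (Fin n → ℝ) × ℝ => 2⁻¹ * ((∑ i, p.1 i) / (√n * s)) ^ 2
      + (∑ i, p.1 i) / (√n * s) * p.2) (P.prod (gaussianReal 0 1)) := i1.add i2
  rw [integral_add i12 i3, integral_add i1 i2, integral_const_mul, integral_const_mul,
    integral_prod_mul (fun u : Fin n → ℝ => (∑ i, u i) / (√n * s)) (fun g : ℝ => g),
    integral_standardised_sum hs.le h,
    integral_fun_fst (fun u : Fin n → ℝ => ((∑ i, u i) / (√n * s)) ^ 2),
    integral_fun_snd (fun g : ℝ => g ^ 2), integral_standardised_sum_sq hν hs h hn,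
    integral_sq_gaussianReal]
  norm_num

lemma pi_threePointLaw_real_ne_zero_le (hs : 0 ≤ s) (h : 3 * s ^ (2 * ν / (ν - 2)) ≤ 1) :
    (Measure.pi fun _ : Fin n => threePointLaw ν s).real {u | u ≠ 0}
      ≤ n * (3 * s ^ (2 * ν / (ν - 2))) := by
  have := isProbabilityMeasure_threePointLaw hs h
  have hm : MeasurableSet {u : ℝ | u ≠ 0} := (measurableSet_singleton (0 : ℝ)).compl
  have hset : {u : Fin n → ℝ | u ≠ 0} = ⋃ i, (fun u : Fin n → ℝ => u i) ⁻¹' {x | x ≠ 0} := by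
    ext u; simp [Function.ne_iff]
  rw [hset]
  refine (measureReal_iUnion_fintype_le _).trans ?_
  calc _ ≤ ∑ _i : Fin n, 3 * s ^ (2 * ν / (ν - 2)) := Finset.sum_le_sum fun i _ => by
        have := (measurePreserving_eval (fun _ : Fin n => threePointLaw ν s) i).measureReal_preimage
          hm.nullMeasurableSet
        exact this.le.trans (threePointLaw_real_ne_zero_le hs h)
    _ = _ := by simp

lemma sqrt_le_mul_sq_add_inv {ε x : ℝ} (hε : 0 < ε) (hε1 : ε ≤ 1) (hx : 0 ≤ x) :
    √x ≤ ε * x ^ 2 + ε⁻¹ := by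
  have h1 : 1 ≤ ε⁻¹ := (one_le_inv₀ hε).2 hε1
  have h0 : 0 ≤ ε * x ^ 2 := by positivity
  rcases le_total x ε⁻¹ with h | h
  · have : √x ≤ ε⁻¹ := Real.sqrt_le_iff.2 ⟨by positivity, by nlinarith⟩
    linarith
  · have h2 : √x ≤ x := Real.sqrt_le_iff.2 ⟨hx, by nlinarith⟩
    have h3 : 1 ≤ ε * x := by
      calc (1 : ℝ) = ε * ε⁻¹ := by field_simp
        _ ≤ ε * x := by gcongr
    nlinarith

/-- With high probability all `U_i` vanish, and then `Q = G / √2` has a negative part with a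
smaller half-order moment than that of a standard normal variable. On the exceptional event the
bound `√|q| ≤ ε q ^ 2 + ε⁻¹` and the second moment of `Q` suffice. -/
lemma integral_sqrt_neg_mixLaw_le (hν : 2 < ν) (hs : 0 < s)
    (h : 3 * s ^ (2 * ν / (ν - 2)) ≤ 1) (hn : 0 < n) {ε : ℝ} (hε : 0 < ε) (hε1 : ε ≤ 1) :
    ∫ q, √(-q) ∂(mixLaw ν s n) ≤ (√√2)⁻¹ * ∫ g, √(-g) ∂(gaussianReal 0 1) + ε
      + ε⁻¹ * (n * (3 * s ^ (2 * ν / (ν - 2)))) := by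
  have := isProbabilityMeasure_threePointLaw hs.le h
  have hq2 := integral_sq_mixLaw hν hs h hn
  have hB := pi_threePointLaw_real_ne_zero_le (n := n) hs.le h
  have hG : Integrable (fun x : ℝ => x ^ 2) (gaussianReal 0 1) :=
    (memLp_id_gaussianReal' 2 (by simp)).integrable_sq
  have hmB : MeasurableSet {u : Fin n → ℝ | u ≠ 0} :=
    (measurableSet_singleton (0 : Fin n → ℝ)).compl
  have hi := integrable_sq_add_div (ν := ν) (s := s) (n := n)
  have hi' := integrable_sqrt_neg (κ := gaussianReal 0 1) hG
  have hmix := isProbabilityMeasure_mixLaw (ν := ν) (s := s) n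
  have hsq := integrable_sqrt_neg (integrable_sq_mixLaw (ν := ν) (s := s) (n := n))
  rw [mixLaw, integrable_map_measure (by fun_prop) (by fun_prop)] at hsq
  rw [mixLaw, integral_map (by fun_prop) (by fun_prop)] at hq2 ⊢
  set P := Measure.pi fun _ : Fin n => threePointLaw ν s
  set B := {u : Fin n → ℝ | u ≠ 0}
  have j1 : Integrable (fun p : (Fin n → ℝ) × ℝ => (√√2)⁻¹ * √(-p.2))
      (P.prod (gaussianReal 0 1)) := (hi'.comp_snd _).const_mul _
  have j3 : Integrable (fun p : (Fin n → ℝ) × ℝ => ε⁻¹ * B.indicator (1 : (Fin n → ℝ) → ℝ) p.1)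
      (P.prod (gaussianReal 0 1)) :=
    (Integrable.comp_fst ((integrable_const (1 : ℝ)).indicator hmB) _).const_mul _
  have hpt : ∀ p : (Fin n → ℝ) × ℝ, √(-(((∑ i, p.1 i) / (√n * s) + p.2) / √2)) ≤
      (√√2)⁻¹ * √(-p.2) + ε * (((∑ i, p.1 i) / (√n * s) + p.2) / √2) ^ 2
        + ε⁻¹ * B.indicator (1 : (Fin n → ℝ) → ℝ) p.1 := fun p => by
    by_cases hp : p.1 = 0
    · have e : -(((∑ i, p.1 i) / (√n * s) + p.2) / √2) = (√2)⁻¹ * -p.2 := by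
        simp [hp]; ring
      rw [e, Real.sqrt_mul (by positivity), Real.sqrt_inv]
      have : 0 ≤ B.indicator (1 : (Fin n → ℝ) → ℝ) p.1 :=
        Set.indicator_nonneg (fun _ _ => zero_le_one) _
      have : 0 ≤ ε⁻¹ * B.indicator (1 : (Fin n → ℝ) → ℝ) p.1 := by positivity
      have : 0 ≤ ε * (((∑ i, p.1 i) / (√n * s) + p.2) / √2) ^ 2 := by positivity
      linarith
    · have e : B.indicator (1 : (Fin n → ℝ) → ℝ) p.1 = 1 := Set.indicator_of_mem hp _
      rw [e, mul_one]
      set x := ((∑ i, p.1 i) / (√n * s) + p.2) / √2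
      have h1 := Real.sqrt_le_sqrt (neg_le_abs x)
      have h2 := sqrt_le_mul_sq_add_inv hε hε1 (abs_nonneg x)
      rw [sq_abs] at h2
      have h3 : 0 ≤ (√√2)⁻¹ * √(-p.2) := by positivity
      linarith
  refine (integral_mono hsq ((j1.add (hi.const_mul ε)).add j3) hpt).trans ?_
  have hind : ∫ u, B.indicator (1 : (Fin n → ℝ) → ℝ) u ∂P = P.real B := integral_indicator_one hmB
  rw [integral_add' (j1.add (hi.const_mul ε)) j3, integral_add' j1 (hi.const_mul ε),
    integral_const_mul, integral_const_mul, integral_const_mul, hq2,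
    integral_fun_snd (fun g : ℝ => √(-g)),
    integral_fun_fst (B.indicator (1 : (Fin n → ℝ) → ℝ)), hind]
  simp only [probReal_univ, one_smul, mul_one]
  gcongr

end MixLaw

lemma integral_sqrt_neg_gaussianReal_pos : 0 < ∫ g, √(-g) ∂(gaussianReal 0 1) := by
  have hG : Integrable (fun x : ℝ => x ^ 2) (gaussianReal 0 1) :=
    (memLp_id_gaussianReal' 2 (by simp)).integrable_sq
  rw [integral_pos_iff_support_of_nonneg (fun g => Real.sqrt_nonneg _) (integrable_sqrt_neg hG)]
  have hsupp : Function.support (fun g : ℝ => √(-g)) = Set.Iio 0 := by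
    ext g; simp [Real.sqrt_eq_zero']
  rw [hsupp, pos_iff_ne_zero]
  intro h0
  have := gaussianReal_absolutelyContinuous' 0 (one_ne_zero : (1 : NNReal) ≠ 0) h0
  simp at this

/-! ### Heavy-tailed realizations in every dimension -/

/-- The point `(r, 0, …, 0)` of `ℝ^d`; for `d = 0` the only point there is. -/
noncomputable def firstAxis : (d : ℕ) → ℝ → EuclideanSpace ℝ (Fin d)
  | 0, _ => 0
  | _ + 1, r => EuclideanSpace.single 0 r

/-- The first coordinate of a point of `ℝ^d`, set to `0` for `d = 0`. -/
noncomputable def firstCoord : (d : ℕ) → EuclideanSpace ℝ (Fin d) → ℝ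
  | 0, _ => 0
  | _ + 1, x => x 0

lemma measurable_firstAxis (d : ℕ) : Measurable (firstAxis d) := by
  cases d with
  | zero => exact measurable_const
  | succ d =>
    have : firstAxis (d + 1) = fun r : ℝ =>
        r • EuclideanSpace.single (0 : Fin (d + 1)) (1 : ℝ) := by
      ext r i; simp [firstAxis]
    rw [this]
    exact (continuous_id.smul continuous_const).measurable

lemma measurable_firstCoord (d : ℕ) : Measurable (firstCoord d) := by
  cases d with
  | zero => exact measurable_const
  | succ d =>
    exact (EuclideanSpace.proj (0 : Fin (d + 1)) :
      EuclideanSpace ℝ (Fin (d + 1)) →L[ℝ] ℝ).continuous.measurable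

lemma firstCoord_firstAxis {d : ℕ} (hd : 1 ≤ d) (r : ℝ) : firstCoord d (firstAxis d r) = r := by
  cases d with
  | zero => omega
  | succ d => simp [firstCoord, firstAxis]

lemma enorm_firstAxis {d : ℕ} (hd : 1 ≤ d) (r : ℝ) : ‖firstAxis d r‖ₑ = ‖r‖ₑ := by
  cases d with
  | zero => omega
  | succ d => simp [firstAxis, enorm_eq_nnnorm]

/-- A Borel isomorphism of the plane with `[0, 1)`. -/
noncomputable def planeEquivIco : ℝ × ℝ ≃ᵐ Set.Ico (0 : ℝ) 1 :=
  have : StandardBorelSpace (Set.Ico (0 : ℝ) 1) := measurableSet_Ico.standardBorel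
  PolishSpace.measurableEquivOfNotCountable
    (fun _ => not_countable (α := ℝ) (Function.Injective.countable
      (f := fun x : ℝ => (x, (0 : ℝ))) fun _ _ hxy => congrArg Prod.fst hxy))
    (fun h => (Cardinal.Real.Ico_countable_iff.1 (Set.countable_coe_iff.1 h)).not_gt zero_lt_one)

/-- A real number that determines the point `y` of the plane and lies within `1` of `|y.1|`: its
integer part is that of `|y.1|` and its fractional part encodes `y`. -/
noncomputable def encodePlane (y : ℝ × ℝ) : ℝ := ⌊|y.1|⌋ + (planeEquivIco y : ℝ)

/-- The left inverse of `encodePlane` that reads off the fractional part. -/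
noncomputable def decodePlane (x : ℝ) : ℝ × ℝ :=
  planeEquivIco.symm ⟨Int.fract x, Int.fract_nonneg x, Int.fract_lt_one x⟩

lemma measurable_encodePlane : Measurable encodePlane := by
  have h1 : Measurable fun y : ℝ × ℝ => (⌊|y.1|⌋ : ℝ) :=
    (measurable_from_top (f := fun z : ℤ => (z : ℝ))).comp
      (Int.measurable_floor.comp (measurable_fst.abs))
  exact h1.add (measurable_subtype_coe.comp planeEquivIco.measurable)

lemma measurable_decodePlane : Measurable decodePlane :=
  planeEquivIco.symm.measurable.comp (measurable_fract.subtype_mk)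

lemma decodePlane_encodePlane (y : ℝ × ℝ) : decodePlane (encodePlane y) = y := by
  have h : Int.fract (encodePlane y) = planeEquivIco y := by
    rw [encodePlane, Int.fract_intCast_add]
    exact Int.fract_eq_self.2 (planeEquivIco y).2
  simp [decodePlane, h]

lemma encodePlane_le (y : ℝ × ℝ) : encodePlane y ≤ |y.1| + 1 :=
  add_le_add (Int.floor_le _) (planeEquivIco y).2.2.le

lemma le_encodePlane (y : ℝ × ℝ) : |y.1| - 1 ≤ encodePlane y := by
  have h1 := (Int.lt_floor_add_one |y.1|).le
  have h2 := (planeEquivIco y).2.1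
  unfold encodePlane
  linarith

lemma encodePlane_nonneg (y : ℝ × ℝ) : 0 ≤ encodePlane y :=
  add_nonneg (by exact_mod_cast Int.floor_nonneg.2 (abs_nonneg y.1)) (planeEquivIco y).2.1

/-- The law on the first axis of `ℝ^d` of the code of `Y`. Its tail is that of the first
coordinate of `Y`. -/
noncomputable def axisLaw (ν s : ℝ) (d : ℕ) : Measure (EuclideanSpace ℝ (Fin d)) :=
  (planeLaw ν s).map fun y => firstAxis d (encodePlane y)

lemma isRealization_axisLaw {ν s : ℝ} [IsProbabilityMeasure (threePointLaw ν s)] {d : ℕ}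
    (hd : 1 ≤ d) : IsRealization ν s (axisLaw ν s d) (fun x => decodePlane (firstCoord d x)) := by
  have : IsProbabilityMeasure (planeLaw ν s) := Measure.isProbabilityMeasure_map (by fun_prop)
  have hm := (measurable_firstAxis d).comp measurable_encodePlane
  have hm' := measurable_decodePlane.comp (measurable_firstCoord d)
  refine ⟨Measure.isProbabilityMeasure_map hm.aemeasurable, hm', ?_⟩
  have := Measure.map_map (μ := planeLaw ν s) hm' hm
  simp only [Function.comp_def, firstCoord_firstAxis hd, decodePlane_encodePlane] at this
  rw [axisLaw, this]
  exact Measure.map_id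

lemma lintegral_axisLaw {ν s : ℝ} {d : ℕ} (hd : 1 ≤ d) (p : ℝ) :
    ∫⁻ x, ‖x‖ₑ ^ p ∂(axisLaw ν s d) =
      ∫⁻ q, ‖encodePlane (q.1 / √2 + s / √2 * q.2.1, q.2.2)‖ₑ ^ p
        ∂((threePointLaw ν s).prod ((gaussianReal 0 1).prod (gaussianReal 0 1))) := by
  have hm : Measurable fun y => firstAxis d (encodePlane y) :=
    (measurable_firstAxis d).comp measurable_encodePlane
  have he := measurable_encodePlane
  rw [axisLaw, lintegral_map (by fun_prop) hm]
  simp only [enorm_firstAxis hd]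
  rw [planeLaw, lintegral_map (by fun_prop) (by fun_prop)]

/-- The weights of the three-point law are chosen so that its `ν`-th moment does not depend on
the scale `s`. -/
lemma lintegral_threePointLaw_le {ν s : ℝ} (hν : 2 < ν) (hν' : ν ≤ 3) (hs : 0 < s)
    (h : 3 * s ^ (2 * ν / (ν - 2)) ≤ 1) :
    ∫⁻ u, ‖u‖ₑ ^ ν ∂(threePointLaw ν s) ≤ 10 := by
  have h0 : 0 < ν - 2 := by linarith
  have he : ∀ u : ℝ, ‖u‖ₑ ^ ν = ENNReal.ofReal (|u| ^ ν) := fun u => by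
    rw [← ofReal_norm, Real.norm_eq_abs,
      ENNReal.ofReal_rpow_of_nonneg (abs_nonneg u) (by linarith)]
  simp only [he]
  rw [← ofReal_integral_eq_lintegral_ofReal (integrable_threePointLaw _)
    (ae_of_all _ fun u => by positivity), integral_threePointLaw hs.le h fun u => |u| ^ ν]
  have hs' : 0 < s ^ (-2 / (ν - 2)) := Real.rpow_pos_of_pos hs _
  have h6 : 1 ≤ √(6 : ℝ) := Real.one_le_sqrt.2 (by norm_num)
  have h6' : (√(6 : ℝ))⁻¹ ≤ 1 := inv_le_one_of_one_le₀ h6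
  have hp : 0 < s ^ (2 * ν / (ν - 2)) := Real.rpow_pos_of_pos hs _
  have hpow : s ^ (2 * ν / (ν - 2)) * (s ^ (-2 / (ν - 2))) ^ ν = 1 := by
    rw [← Real.rpow_mul hs.le, ← Real.rpow_add hs]
    convert Real.rpow_zero s using 2
    field_simp; ring
  have e1 : s ^ (2 * ν / (ν - 2)) * |-((√6)⁻¹ * s ^ (-2 / (ν - 2)))| ^ ν ≤ 1 := by
    rw [abs_neg, abs_of_nonneg (by positivity), ← hpow]
    gcongr
    nlinarith
  have e2 : s ^ (2 * ν / (ν - 2)) * |2 * (√6)⁻¹ * s ^ (-2 / (ν - 2))| ^ ν ≤ 8 := by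
    rw [abs_of_nonneg (by positivity), mul_assoc,
      Real.mul_rpow (by norm_num) (by positivity)]
    have : (2 : ℝ) ^ ν ≤ 8 := by
      calc (2 : ℝ) ^ ν ≤ 2 ^ (3 : ℝ) := Real.rpow_le_rpow_of_exponent_le (by norm_num) hν'
        _ = 8 := by norm_num
    calc s ^ (2 * ν / (ν - 2)) * (2 ^ ν * ((√6)⁻¹ * s ^ (-2 / (ν - 2))) ^ ν)
        = 2 ^ ν * (s ^ (2 * ν / (ν - 2)) * ((√6)⁻¹ * s ^ (-2 / (ν - 2))) ^ ν) := by ring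
      _ ≤ 8 * 1 := by
        gcongr
        rw [abs_neg, abs_of_nonneg (by positivity)] at e1
        exact e1
      _ = 8 := by norm_num
  have e3 : |(0 : ℝ)| ^ ν = 0 := by rw [abs_zero, Real.zero_rpow (by linarith)]
  rw [e3, show (10 : ℝ≥0∞) = ENNReal.ofReal 10 by simp]
  exact ENNReal.ofReal_le_ofReal (by linarith)

/-- The `ν`-th moment of `axisLaw` is bounded uniformly in the dimension and in the scale. -/
lemma lintegral_axisLaw_le {ν : ℝ} (hν : 2 < ν) (hν' : ν ≤ 3) :
    ∃ M : ℝ, ∀ s : ℝ, 0 < s → s ≤ 1 → 3 * s ^ (2 * ν / (ν - 2)) ≤ 1 → ∀ d : ℕ, 1 ≤ d →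
      ∫⁻ x, ‖x‖ₑ ^ ν ∂(axisLaw ν s d) ≤ ENNReal.ofReal M := by
  have hν1 : 1 ≤ ν := by linarith
  have hG : ∫⁻ g, ‖g‖ₑ ^ ν ∂(gaussianReal 0 1) ≠ ⊤ := by
    have := lintegral_rpow_enorm_lt_top_of_eLpNorm_lt_top 
      (p := ENNReal.ofReal ν) (by simp; linarith) (by simp)
      (memLp_id_gaussianReal' (μ := 0) (v := 1) (ENNReal.ofReal ν) (by simp)).2
    rw [ENNReal.toReal_ofReal (by linarith)] at this
    exact this.ne
  set K : ℝ≥0∞ := 2 ^ (ν - 1) * (10 + 2 ^ (ν - 1) * (∫⁻ g, ‖g‖ₑ ^ ν ∂(gaussianReal 0 1) + 1))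
  have h2 : (2 : ℝ≥0∞) ^ (ν - 1) ≠ ⊤ := ENNReal.rpow_ne_top_of_nonneg (by linarith) (by simp)
  have hK : K ≠ ⊤ := by finiteness
  refine ⟨K.toReal, fun s hs hs1 h d hd => ?_⟩
  have := isProbabilityMeasure_threePointLaw hs.le h
  rw [ENNReal.ofReal_toReal hK, lintegral_axisLaw hd]
  have hpt : ∀ q : ℝ × ℝ × ℝ, ‖encodePlane (q.1 / √2 + s / √2 * q.2.1, q.2.2)‖ₑ ^ ν ≤
      2 ^ (ν - 1) * (‖q.1‖ₑ ^ ν + 2 ^ (ν - 1) * (‖q.2.1‖ₑ ^ ν + 1)) := fun q => by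
    have hr : ‖encodePlane (q.1 / √2 + s / √2 * q.2.1, q.2.2)‖ ≤ ‖q.1‖ + (‖q.2.1‖ + 1) := by
      have hsq : 1 ≤ √(2 : ℝ) := Real.one_le_sqrt.2 (by norm_num)
      have hb := encodePlane_le (q.1 / √2 + s / √2 * q.2.1, q.2.2)
      rw [Real.norm_of_nonneg (encodePlane_nonneg _)]
      have h3 : |q.1 / √2 + s / √2 * q.2.1| ≤ |q.1| + |q.2.1| := by
        refine (abs_add_le _ _).trans (add_le_add ?_ ?_)
        · rw [abs_div, abs_of_pos (by positivity : 0 < √(2 : ℝ))]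
          exact div_le_self (abs_nonneg _) hsq
        · rw [abs_mul, abs_of_nonneg (by positivity : 0 ≤ s / √2)]
          refine mul_le_of_le_one_left (abs_nonneg _) ?_
          exact (div_le_self hs.le hsq).trans hs1
      simp only [Real.norm_eq_abs]
      simp only at hb
      linarith
    have he : ‖encodePlane (q.1 / √2 + s / √2 * q.2.1, q.2.2)‖ₑ ≤ ‖q.1‖ₑ + (‖q.2.1‖ₑ + 1) := by
      simp only [← ofReal_norm]
      rw [← ENNReal.ofReal_one, ← ENNReal.ofReal_add (norm_nonneg _) zero_le_one,
        ← ENNReal.ofReal_add (norm_nonneg _) (by positivity)]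
      exact ENNReal.ofReal_le_ofReal hr
    refine (ENNReal.rpow_le_rpow he (by linarith)).trans ?_
    refine (ENNReal.rpow_add_le_mul_rpow_add_rpow _ _ hν1).trans ?_
    gcongr
    refine (ENNReal.rpow_add_le_mul_rpow_add_rpow _ _ hν1).trans ?_
    rw [ENNReal.one_rpow]
  refine (lintegral_mono hpt).trans ?_
  have hu : ∫⁻ q : ℝ × ℝ × ℝ, ‖q.1‖ₑ ^ ν
      ∂((threePointLaw ν s).prod ((gaussianReal 0 1).prod (gaussianReal 0 1)))
      = ∫⁻ u, ‖u‖ₑ ^ ν ∂(threePointLaw ν s) :=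
    measurePreserving_fst.lintegral_comp (f := fun u : ℝ => ‖u‖ₑ ^ ν) (by fun_prop)
  have hg : ∫⁻ q : ℝ × ℝ × ℝ, ‖q.2.1‖ₑ ^ ν
      ∂((threePointLaw ν s).prod ((gaussianReal 0 1).prod (gaussianReal 0 1)))
      = ∫⁻ g, ‖g‖ₑ ^ ν ∂(gaussianReal 0 1) :=
    (measurePreserving_fst.comp measurePreserving_snd).lintegral_comp
      (f := fun u : ℝ => ‖u‖ₑ ^ ν) (by fun_prop)
  rw [lintegral_const_mul _ (by fun_prop), lintegral_add_left (by fun_prop),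
    lintegral_const_mul _ (by fun_prop), lintegral_add_left (by fun_prop), hu, hg]
  simp only [lintegral_const, measure_univ, mul_one]
  exact mul_le_mul_right (add_le_add_left (lintegral_threePointLaw_le hν hν' hs h) _) _

lemma gaussianReal_Ici_pos : 0 < (gaussianReal 0 1).real (Set.Ici 0) := by
  rw [Measure.real, ENNReal.toReal_pos_iff]
  refine ⟨?_, measure_lt_top _ _⟩
  rw [pos_iff_ne_zero]
  intro h0
  have := gaussianReal_absolutelyContinuous' 0 (one_ne_zero : (1 : NNReal) ≠ 0) h0
  simp at this

/-- The contribution to the `p`-th moment of `axisLaw` of the event that `U_s` takes its largest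
value and `ξ₁` is nonnegative. -/
lemma le_lintegral_axisLaw {ν s p : ℝ} (hs : 0 < s) (hp : 0 ≤ p) {d : ℕ} (hd : 1 ≤ d)
    (hb : 2 ≤ 2 * (√6)⁻¹ * s ^ (-2 / (ν - 2)) / √2) :
    ENNReal.ofReal (((√6)⁻¹ * s ^ (-2 / (ν - 2)) / √2) ^ p *
      (s ^ (2 * ν / (ν - 2)) * (gaussianReal 0 1).real (Set.Ici 0)))
      ≤ ∫⁻ x, ‖x‖ₑ ^ p ∂(axisLaw ν s d) := by
  rw [lintegral_axisLaw hd]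
  have he := measurable_encodePlane
  set a := (√6)⁻¹ * s ^ (-2 / (ν - 2)) / √2 with ha
  have ha0 : 0 ≤ a := by have := Real.rpow_nonneg hs.le (-2 / (ν - 2)); positivity
  set top := 2 * (√6)⁻¹ * s ^ (-2 / (ν - 2)) with htop
  have hta : top / √2 = 2 * a := by rw [ha, htop]; ring
  have h1 : ENNReal.ofReal (s ^ (2 * ν / (ν - 2))) ≤ threePointLaw ν s {top} := by
    simp only [threePointLaw, Measure.add_apply, Measure.smul_apply, smul_eq_mul]
    rw [Measure.dirac_apply' top (measurableSet_singleton _)]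
    simp
  refine le_trans ?_ (mul_meas_ge_le_lintegral (by fun_prop) (ENNReal.ofReal (a ^ p)))
  rw [ENNReal.ofReal_mul (by positivity)]
  gcongr
  have hsub : ({top} : Set ℝ) ×ˢ (Set.Ici (0 : ℝ) ×ˢ (Set.univ : Set ℝ)) ⊆
      {q | ENNReal.ofReal (a ^ p) ≤ ‖encodePlane (q.1 / √2 + s / √2 * q.2.1, q.2.2)‖ₑ ^ p} := by
    rintro ⟨u, g, z⟩ ⟨hu, hg, -⟩
    simp only [Set.mem_singleton_iff, Set.mem_Ici] at hu hg
    subst hu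
    simp only [Set.mem_ofPred_eq]
    rw [← ofReal_norm, ENNReal.ofReal_rpow_of_nonneg (norm_nonneg _) hp,
      Real.norm_of_nonneg (encodePlane_nonneg _)]
    refine ENNReal.ofReal_le_ofReal (Real.rpow_le_rpow ha0 ?_ hp)
    refine le_trans ?_ (le_encodePlane _)
    simp only
    have hnn : 0 ≤ s / √2 * g := by positivity
    rw [hta] at hb ⊢
    rw [abs_of_nonneg (by positivity)]
    linarith
  refine le_trans ?_ (measure_mono hsub)
  rw [Measure.prod_prod, Measure.prod_prod, measure_univ, mul_one,
    ENNReal.ofReal_mul (by positivity), ofReal_measureReal]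
  gcongr

/-- Moments of order above `ν` blow up as the scale tends to zero, uniformly in the dimension. -/
lemma eventually_le_lintegral_axisLaw {ν p : ℝ} (hν : 2 < ν) (hp : ν < p) (K : ℝ) :
    ∀ᶠ s in 𝓝[>] (0 : ℝ), ∀ d : ℕ, 1 ≤ d →
      ENNReal.ofReal K ≤ ∫⁻ x, ‖x‖ₑ ^ p ∂(axisLaw ν s d) := by
  have h0 : 0 < ν - 2 := by linarith
  set c := (gaussianReal 0 1).real (Set.Ici 0)
  have hc : 0 < c := gaussianReal_Ici_pos
  have t1 : Tendsto (fun s : ℝ => s ^ (-2 / (ν - 2))) (𝓝[>] 0) atTop :=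
    tendsto_rpow_neg_nhdsGT_zero (div_neg_of_neg_of_pos (by norm_num) h0)
  have t2 : Tendsto (fun s : ℝ => s ^ (2 * (ν - p) / (ν - 2))) (𝓝[>] 0) atTop :=
    tendsto_rpow_neg_nhdsGT_zero (div_neg_of_neg_of_pos (by linarith) h0)
  have hk : 0 < (√6)⁻¹ / √2 := by positivity
  filter_upwards [self_mem_nhdsWithin, t1.eventually_ge_atTop (((√6)⁻¹ / √2)⁻¹),
    t2.eventually_ge_atTop (K / (((√6)⁻¹ / √2) ^ p * c))] with s hs h1 h2 d hd
  have hs : 0 < s := hs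
  rw [inv_le_iff_one_le_mul₀ hk] at h1
  refine le_trans (ENNReal.ofReal_le_ofReal ?_)
    (le_lintegral_axisLaw (ν := ν) (p := p) hs (by linarith) hd ?_)
  · have hs' := Real.rpow_nonneg hs.le (-2 / (ν - 2))
    rw [div_le_iff₀ (by positivity)] at h2
    refine h2.trans (le_of_eq ?_)
    rw [show (√6)⁻¹ * s ^ (-2 / (ν - 2)) / √2 = (√6)⁻¹ / √2 * s ^ (-2 / (ν - 2)) by ring,
      Real.mul_rpow hk.le hs', ← Real.rpow_mul hs.le]
    have : s ^ (2 * (ν - p) / (ν - 2))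
        = s ^ (-2 / (ν - 2) * p) * s ^ (2 * ν / (ν - 2)) := by
      rw [← Real.rpow_add hs]; congr 1; field_simp; ring
    rw [this]; ring
  · calc (2 : ℝ) = 2 * 1 := by ring
      _ ≤ 2 * (s ^ (-2 / (ν - 2)) * ((√6)⁻¹ / √2)) := by gcongr
      _ = _ := by ring

/-! ### Error bounds -/

lemma gaussChi_real_le (s t : ℝ) :
    gaussChi.real {p | s * p.1 + p.2 ≤ t} = shiftedCdf (gaussianReal 0 1) s t := by
  have h : gaussChi = ((gaussianReal 0 1).prod (gaussianReal 0 1)).map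
      (Prod.map id fun x : ℝ => x ^ 2) := by
    rw [gaussChi, chiSqOne]
    nth_rewrite 1 [← Measure.map_id (μ := gaussianReal 0 1)]
    exact Measure.map_prod_map _ _ measurable_id (by fun_prop)
  rw [h, map_measureReal_apply (by fun_prop) (measurableSet_le (by fun_prop) (by fun_prop))]
  rfl

lemma planeKernelU_comm (n : ℕ) (a b : ℝ × ℝ) : planeKernelU n a b = planeKernelU n b a := by
  unfold planeKernelU; ring

lemma planeKernelV_comm (n : ℕ) (a b : ℝ × ℝ) : planeKernelV n a b = planeKernelV n b a := by
  unfold planeKernelV; ring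

lemma abs_shiftedCdf_mixLaw_sub_le {ν s : ℝ} (hν : 2 < ν) (hs : 0 < s)
    (h3 : 3 * s ^ (2 * ν / (ν - 2)) ≤ 1) {n : ℕ} (hn : 0 < n) (t : ℝ) :
    |shiftedCdf (mixLaw ν s n) s t - shiftedCdf (gaussianReal 0 1) s t| ≤ 4 * √s := by
  have := isProbabilityMeasure_threePointLaw hs.le h3
  have := isProbabilityMeasure_mixLaw (ν := ν) (s := s) n
  have h1 := abs_shiftedCdf_sub_sqCdf_le (mixLaw ν s n) hs.le integrable_sq_mixLaw
    (integral_sq_mixLaw hν hs h3 hn).le t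
  have h2 := abs_shiftedCdf_sub_sqCdf_le (gaussianReal 0 1) hs.le
    ((memLp_id_gaussianReal' 2 (by simp)).integrable_sq) integral_sq_gaussianReal.le t
  simp only [abs_le] at *
  constructor <;> linarith

/-- At `t = 0` the distribution functions of `s ξ + W ^ 2` and `s Q + W ^ 2` differ by the order
`√s`, since the half-order moments of the negative parts of `ξ` and `Q` differ. -/
lemma le_shiftedCdf_sub_mixLaw {ν s : ℝ} (hν : 2 < ν) (hs : 0 < s)
    (h3 : 3 * s ^ (2 * ν / (ν - 2)) ≤ 1) {n : ℕ} (hn : 0 < n) {ε : ℝ} (hε : 0 < ε) (hε1 : ε ≤ 1) :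
    sqCdfSlope * √s * ((1 - (√√2)⁻¹) * ∫ g, √(-g) ∂(gaussianReal 0 1) - s - ε
      - ε⁻¹ * (n * (3 * s ^ (2 * ν / (ν - 2)))))
      ≤ shiftedCdf (gaussianReal 0 1) s 0 - shiftedCdf (mixLaw ν s n) s 0 := by
  have := isProbabilityMeasure_threePointLaw hs.le h3
  have := isProbabilityMeasure_mixLaw (ν := ν) (s := s) n
  have h1 := shiftedCdf_zero_le (mixLaw ν s n) hs.le integrable_sq_mixLaw
  have h2 := le_shiftedCdf_zero (gaussianReal 0 1) hs.le
    ((memLp_id_gaussianReal' 2 (by simp)).integrable_sq) integral_sq_gaussianReal.le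
  have h4 := mul_le_mul_of_nonneg_left (integral_sqrt_neg_mixLaw_le hν hs h3 hn hε hε1)
    (mul_nonneg sqCdfSlope_pos.le (Real.sqrt_nonneg s))
  linarith

lemma iSup_bounds {f : ℝ → ℝ} {b B : ℝ} (hB : ∀ t, f t ≤ B) {t₀ : ℝ} (hb : b ≤ f t₀) :
    b ≤ ⨆ t, f t ∧ ⨆ t, f t ≤ B :=
  ⟨hb.trans (le_ciSup (f := f) ⟨B, by rintro _ ⟨t, rfl⟩; exact hB t⟩ t₀), ciSup_le hB⟩

lemma IsRealization.vError_bounds {ν s : ℝ} (hν : 2 < ν) (hs : 0 < s)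
    (h3 : 3 * s ^ (2 * ν / (ν - 2)) ≤ 1) {n d : ℕ} (hn : 0 < n)
    {μ : Measure (EuclideanSpace ℝ (Fin d))} {φ : EuclideanSpace ℝ (Fin d) → ℝ × ℝ}
    (h : IsRealization ν s μ φ) :
    shiftedCdf (gaussianReal 0 1) s 0 - shiftedCdf (mixLaw ν s n) s 0
      ≤ vError s n μ (kernelV n φ) ∧ vError s n μ (kernelV n φ) ≤ 4 * √s := by
  have := isProbabilityMeasure_threePointLaw hs.le h3
  unfold vError
  simp only [h.pi_real_vStat_le hs hn, gaussChi_real_le]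
  refine iSup_bounds (fun t => abs_shiftedCdf_mixLaw_sub_le hν hs h3 hn t) (t₀ := 0) ?_
  rw [abs_sub_comm]
  exact le_abs_self _

lemma IsRealization.uError_bounds {ν s : ℝ} (hν : 2 < ν) (hs : 0 < s)
    (h3 : 3 * s ^ (2 * ν / (ν - 2)) ≤ 1) {n d : ℕ} (hn : 1 < n)
    {μ : Measure (EuclideanSpace ℝ (Fin d))} {φ : EuclideanSpace ℝ (Fin d) → ℝ × ℝ}
    (h : IsRealization ν s μ φ) {δ : ℝ} (hδ : 0 < δ) :
    shiftedCdf (gaussianReal 0 1) s 0 - shiftedCdf (mixLaw ν s n) s 0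
        - (Var[fun z => z ^ 2; gaussianReal 0 1] / (n * δ ^ 2) + √(2 * δ))
      ≤ uError s n μ (kernelU n φ) ∧
    uError s n μ (kernelU n φ)
      ≤ 4 * √s + (Var[fun z => z ^ 2; gaussianReal 0 1] / (n * δ ^ 2) + √(2 * δ)) := by
  have := isProbabilityMeasure_threePointLaw hs.le h3
  have hchi : ∀ t, gaussChi.real {p | s * p.1 + (p.2 - 1) ≤ t}
      = shiftedCdf (gaussianReal 0 1) s (t + 1) := fun t => by
    rw [← gaussChi_real_le]
    congr 1; ext p; simp only [Set.mem_ofPred_eq]; constructor <;> intro h <;> linarith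
  unfold uError
  simp only [hchi]
  refine iSup_bounds (t₀ := -1) (fun t => ?_) ?_
  · have h1 := h.abs_pi_real_uStat_le_sub hs hn hδ t
    have h2 := abs_shiftedCdf_mixLaw_sub_le hν hs h3 (by omega : 0 < n) (t + 1)
    simp only [abs_le] at *
    constructor <;> linarith
  · have h1 := h.abs_pi_real_uStat_le_sub hs hn hδ (-1)
    rw [neg_add_cancel] at h1 ⊢
    rw [abs_sub_comm]
    refine le_trans ?_ (le_abs_self _)
    have := (abs_le.1 h1).2
    linarith

lemma natCast_rpow_tendsto_zero {a : ℝ} (ha : a < 0) :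
    Tendsto (fun n : ℕ => (n : ℝ) ^ a) atTop (𝓝 0) := by
  have := (tendsto_rpow_neg_atTop (neg_pos.2 ha)).comp tendsto_natCast_atTop_atTop
  simpa [Function.comp_def] using this

lemma sigmaSeq_eventuallyEq {ν σ₀ : ℝ} (hν : 2 < ν) :
    sigmaSeq ν σ₀ =ᶠ[atTop] fun n => σ₀ * (n : ℝ) ^ (-(ν - 2) / (2 * ν)) := by
  have ht := (natCast_rpow_tendsto_zero (a := -(ν - 2) / (2 * ν))
    (div_neg_of_neg_of_pos (by linarith) (by linarith))).const_mul σ₀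
  rw [mul_zero] at ht
  filter_upwards [ht.eventually_le_const zero_lt_one] with n hn
  exact min_eq_left hn

/-- With `δ = n ^ (-2 / 5)` the two parts of the error of the centring term are both of the order
`n ^ (-1 / 5)`. -/
lemma centring_error_le {n : ℕ} (hn : 0 < n) {V : ℝ} :
    V / (n * ((n : ℝ) ^ (-(2 / 5) : ℝ)) ^ 2) + √(2 * (n : ℝ) ^ (-(2 / 5) : ℝ))
      ≤ (V + 2) * (n : ℝ) ^ (-(1 / 5) : ℝ) := by
  have h0 : (0 : ℝ) < n := by exact_mod_cast hn
  have h1 : (n : ℝ) * ((n : ℝ) ^ (-(2 / 5) : ℝ)) ^ 2 = ((n : ℝ) ^ (-(1 / 5) : ℝ))⁻¹ := by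
    rw [← Real.rpow_natCast, ← Real.rpow_mul h0.le, ← Real.rpow_neg h0.le]
    nth_rewrite 1 [← Real.rpow_one (n : ℝ)]
    rw [← Real.rpow_add h0]
    norm_num
  have h2 : (n : ℝ) ^ (-(2 / 5) : ℝ) = ((n : ℝ) ^ (-(1 / 5) : ℝ)) ^ 2 := by
    rw [← Real.rpow_natCast, ← Real.rpow_mul h0.le]; norm_num
  have h3 : √(2 * (n : ℝ) ^ (-(2 / 5) : ℝ)) ≤ 2 * (n : ℝ) ^ (-(1 / 5) : ℝ) := by
    rw [h2]
    refine Real.sqrt_le_iff.2 ⟨by positivity, ?_⟩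
    nlinarith [sq_nonneg ((n : ℝ) ^ (-(1 / 5) : ℝ))]
  rw [h1, div_inv_eq_mul]
  linarith

lemma isTheta_of_bounds {f g : ℕ → ℝ} {c C : ℝ} {N : ℕ} (hc : 0 < c) (hg : ∀ n, 0 ≤ g n)
    (h : ∀ n, N < n → c * g n ≤ f n ∧ f n ≤ C * g n) : f =Θ[atTop] g := by
  have hf : ∀ n, N < n → 0 ≤ f n := fun n hn => (mul_nonneg hc.le (hg n)).trans (h n hn).1
  refine ⟨IsBigO.of_bound C ?_, IsBigO.of_bound c⁻¹ ?_⟩ <;>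
    filter_upwards [eventually_gt_atTop N] with n hn
  · rw [Real.norm_of_nonneg (hf n hn), Real.norm_of_nonneg (hg n)]
    exact (h n hn).2
  · rw [Real.norm_of_nonneg (hf n hn), Real.norm_of_nonneg (hg n), ← div_eq_inv_mul,
      le_div_iff₀ hc, mul_comm]
    exact (h n hn).1

theorem theorem1 (ν : ℝ) (hν₂ : 2 < ν) (hν₃ : ν ≤ 3) :
    ∃ (σ₀ c C : ℝ) (N : ℕ), 0 < σ₀ ∧ 0 < c ∧ 0 < C ∧
      -- the sequence `σ_n` tends to zero, at the stated order
      Tendsto (sigmaSeq ν σ₀) atTop (𝓝 0) ∧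
      (sigmaSeq ν σ₀ =Θ[atTop] fun n : ℕ => (n : ℝ) ^ (-(ν - 2) / (2 * ν))) ∧
      -- the construction exists in every dimension `d ≥ 1`, with heavy-tailed `X`:
      -- bounded `ν`-th moments, while all moments of higher order blow up with `n`
      (∃ (M : ℝ) (μ : ∀ _n d : ℕ, Measure (EuclideanSpace ℝ (Fin d)))
          (φ : ∀ _n d : ℕ, EuclideanSpace ℝ (Fin d) → ℝ × ℝ),
        (∀ n : ℕ, N < n → ∀ d : ℕ, 1 ≤ d →
          IsRealization ν (sigmaSeq ν σ₀ n) (μ n d) (φ n d) ∧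
          ∫⁻ x, ‖x‖ₑ ^ ν ∂(μ n d) ≤ ENNReal.ofReal M) ∧
        (∀ p : ℝ, ν < p → ∀ K : ℝ, ∃ N' : ℕ, ∀ n : ℕ, N' ≤ n → ∀ d : ℕ, 1 ≤ d →
          ENNReal.ofReal K ≤ ∫⁻ x, ‖x‖ₑ ^ p ∂(μ n d))) ∧
      -- every instance of the construction has symmetric kernels and satisfies the bounds
      (∀ n : ℕ, N < n → ∀ (d : ℕ) (μ : Measure (EuclideanSpace ℝ (Fin d)))
          (φ : EuclideanSpace ℝ (Fin d) → ℝ × ℝ),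
        IsRealization ν (sigmaSeq ν σ₀ n) μ φ →
          (∀ x y, kernelU n φ x y = kernelU n φ y x) ∧
          (∀ x y, kernelV n φ x y = kernelV n φ y x) ∧
          c * (n : ℝ) ^ (-(ν - 2) / (4 * ν)) ≤ uError (sigmaSeq ν σ₀ n) n μ (kernelU n φ) ∧
          uError (sigmaSeq ν σ₀ n) n μ (kernelU n φ) ≤ C * (n : ℝ) ^ (-(ν - 2) / (4 * ν)) ∧
          c * (n : ℝ) ^ (-(ν - 2) / (4 * ν)) ≤ vError (sigmaSeq ν σ₀ n) n μ (kernelV n φ) ∧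
          vError (sigmaSeq ν σ₀ n) n μ (kernelV n φ) ≤ C * (n : ℝ) ^ (-(ν - 2) / (4 * ν))) ∧
      -- in particular, the rate for `ν = 3`
      (ν = 3 → ∀ (d : ℕ → ℕ) (μ : ∀ n : ℕ, Measure (EuclideanSpace ℝ (Fin (d n))))
          (φ : ∀ n : ℕ, EuclideanSpace ℝ (Fin (d n)) → ℝ × ℝ),
        (∀ n : ℕ, N < n → IsRealization ν (sigmaSeq ν σ₀ n) (μ n) (φ n)) →
          ((fun n : ℕ => uError (sigmaSeq ν σ₀ n) n (μ n) (kernelU n (φ n)))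
            =Θ[atTop] fun n : ℕ => (n : ℝ) ^ (-(1 / 12) : ℝ)) ∧
          ((fun n : ℕ => vError (sigmaSeq ν σ₀ n) n (μ n) (kernelV n (φ n)))
            =Θ[atTop] fun n : ℕ => (n : ℝ) ^ (-(1 / 12) : ℝ))) := by
  set m := ∫ g, √(-g) ∂(gaussianReal 0 1)
  have hm0 : 0 < m := integral_sqrt_neg_gaussianReal_pos
  have hr : (√√(2 : ℝ))⁻¹ < 1 := by
    refine inv_lt_one_of_one_lt₀ ?_
    rw [Real.lt_sqrt zero_le_one, one_pow, Real.lt_sqrt zero_le_one]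
    norm_num
  set γ := (1 - (√√(2 : ℝ))⁻¹) * m
  have hγ0 : 0 < γ := mul_pos (by linarith) hm0
  -- `γ` is the gap between the half-order moments of the negative parts of `ξ` and of `ξ / √2`.
  -- With `ρ` the mean number `n s ^ (2 ν / (ν - 2))` of times that `U_s` takes its largest value
  -- in a sample of size `n`, the errors `s`, `ε` and `3 ρ / ε` together use up at most half of it.
  set ε := min 1 (γ / 8)
  have hε0 : 0 < ε := lt_min one_pos (by linarith)
  have hε1 : ε ≤ 1 := min_le_left _ _
  have hε2 : ε ≤ γ / 8 := min_le_right _ _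
  set ρ := ε * (γ / 24) with hρ
  have hρ0 : 0 < ρ := by positivity
  have hν0 : 0 < ν := by linarith
  have hν1 : 0 < ν - 2 := by linarith
  set σ₀ := ρ ^ ((ν - 2) / (2 * ν)) with hσ₀
  have hσ0 : 0 < σ₀ := Real.rpow_pos_of_pos hρ0 _
  set V := Var[fun z => z ^ 2; gaussianReal 0 1]
  set c := sqCdfSlope * √σ₀ * (γ / 4) with hc
  have hc0 : 0 < c := by have := sqCdfSlope_pos; positivity
  have hα : -(ν - 2) / (2 * ν) < 0 := div_neg_of_neg_of_pos (by linarith) (by linarith)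
  have hβ : -(1 / 12) ≤ -(ν - 2) / (4 * ν) := by
    rw [le_div_iff₀ (by linarith)]; linarith
  have hσlim : Tendsto (sigmaSeq ν σ₀) atTop (𝓝 0) := by
    refine Tendsto.congr' (sigmaSeq_eventuallyEq hν₂).symm ?_
    simpa using (natCast_rpow_tendsto_zero hα).const_mul σ₀
  have hσpos : ∀ n : ℕ, 0 < n → 0 < sigmaSeq ν σ₀ n := fun n hn =>
    lt_min (mul_pos hσ0 (Real.rpow_pos_of_pos (by exact_mod_cast hn) _)) one_pos
  have hgood : ∀ᶠ n : ℕ in atTop, 1 < n ∧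
      sigmaSeq ν σ₀ n = σ₀ * (n : ℝ) ^ (-(ν - 2) / (2 * ν)) ∧ sigmaSeq ν σ₀ n ≤ γ / 4 ∧
      3 * ρ ≤ n ∧ (V + 2) * (n : ℝ) ^ (-(1 / 5) + (ν - 2) / (4 * ν)) ≤ min c 1 := by
    have hlim := (natCast_rpow_tendsto_zero (a := -(1 / 5) + (ν - 2) / (4 * ν))
      (by rw [neg_div] at hβ; linarith)).const_mul (V + 2)
    rw [mul_zero] at hlim
    filter_upwards [eventually_gt_atTop 1, sigmaSeq_eventuallyEq hν₂,
      hσlim.eventually_le_const (by positivity : 0 < γ / 4),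
      tendsto_natCast_atTop_atTop.eventually_ge_atTop (3 * ρ),
      hlim.eventually_le_const (lt_min hc0 one_pos)] with n h1 h2 h3 h4 h5
    exact ⟨h1, h2, h3, h4, h5⟩
  obtain ⟨N, hN⟩ := eventually_atTop.1 hgood
  have hscale : ∀ n : ℕ, N < n →
      sigmaSeq ν σ₀ n ^ (2 * ν / (ν - 2)) = ρ / n ∧
        3 * sigmaSeq ν σ₀ n ^ (2 * ν / (ν - 2)) ≤ 1 := fun n hn => by
    obtain ⟨h1, h2, -, h4, -⟩ := hN n hn.le
    have hn0 : (0 : ℝ) < n := by exact_mod_cast (by omega : 0 < n)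
    have e : sigmaSeq ν σ₀ n ^ (2 * ν / (ν - 2)) = ρ / n := by
      rw [h2, Real.mul_rpow hσ0.le (by positivity), hσ₀, ← Real.rpow_mul hρ0.le,
        ← Real.rpow_mul hn0.le]
      have e1 : (ν - 2) / (2 * ν) * (2 * ν / (ν - 2)) = 1 := by field_simp
      have e2 : -(ν - 2) / (2 * ν) * (2 * ν / (ν - 2)) = -1 := by rw [neg_div, neg_mul, e1]
      rw [e1, e2, Real.rpow_one, Real.rpow_neg_one, div_eq_mul_inv]
    refine ⟨e, ?_⟩
    rw [e, ← mul_div_assoc, div_le_one hn0]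
    exact h4
  have hmain : ∀ n : ℕ, N < n → ∀ (d : ℕ) (μ : Measure (EuclideanSpace ℝ (Fin d)))
      (φ : EuclideanSpace ℝ (Fin d) → ℝ × ℝ), IsRealization ν (sigmaSeq ν σ₀ n) μ φ →
      c * (n : ℝ) ^ (-(ν - 2) / (4 * ν)) ≤ uError (sigmaSeq ν σ₀ n) n μ (kernelU n φ) ∧
      uError (sigmaSeq ν σ₀ n) n μ (kernelU n φ)
        ≤ (4 * √σ₀ + 1) * (n : ℝ) ^ (-(ν - 2) / (4 * ν)) ∧
      c * (n : ℝ) ^ (-(ν - 2) / (4 * ν)) ≤ vError (sigmaSeq ν σ₀ n) n μ (kernelV n φ) ∧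
      vError (sigmaSeq ν σ₀ n) n μ (kernelV n φ)
        ≤ (4 * √σ₀ + 1) * (n : ℝ) ^ (-(ν - 2) / (4 * ν)) := by
    intro n hn d μ φ hreal
    obtain ⟨h1, h2, h3, -, h5⟩ := hN n hn.le
    obtain ⟨hsc, hsc'⟩ := hscale n hn
    have hn0 : (0 : ℝ) < n := by exact_mod_cast (by omega : 0 < n)
    have hs := hσpos n (by omega)
    have hv := hreal.vError_bounds hν₂ hs hsc' (by omega : 0 < n)
    have hu := hreal.uError_bounds hν₂ hs hsc' h1
      (Real.rpow_pos_of_pos hn0 (-(2 / 5) : ℝ))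
    have hgap := le_shiftedCdf_sub_mixLaw hν₂ hs hsc' (by omega : 0 < n) hε0 hε1
    have hcent := centring_error_le (V := V) (by omega : 0 < n)
    set R := (n : ℝ) ^ (-(ν - 2) / (4 * ν)) with hR
    have hR0 : 0 < R := Real.rpow_pos_of_pos hn0 _
    have hsqrt : √(sigmaSeq ν σ₀ n) = √σ₀ * R := by
      rw [h2, Real.sqrt_mul hσ0.le, Real.sqrt_eq_rpow ((n : ℝ) ^ _), ← Real.rpow_mul hn0.le, hR]
      congr 2; field_simp; norm_num
    have hsmall : (V + 2) * (n : ℝ) ^ (-(1 / 5) : ℝ) ≤ min c 1 * R := by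
      have e : (n : ℝ) ^ (-(1 / 5) : ℝ) = (n : ℝ) ^ (-(1 / 5) + (ν - 2) / (4 * ν)) * R := by
        rw [hR, ← Real.rpow_add hn0]; congr 1; ring
      rw [e, ← mul_assoc]
      gcongr
    have hsmall1 : min c 1 * R ≤ c * R := by gcongr; exact min_le_left _ _
    have hsmall2 : min c 1 * R ≤ 1 * R := by gcongr; exact min_le_right _ _
    have hexc : ε⁻¹ * (n * (3 * sigmaSeq ν σ₀ n ^ (2 * ν / (ν - 2)))) = γ / 8 := by
      rw [hsc, hρ]; field_simp; norm_num
    have hgap2 : 2 * (c * R) ≤ shiftedCdf (gaussianReal 0 1) (sigmaSeq ν σ₀ n) 0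
        - shiftedCdf (mixLaw ν (sigmaSeq ν σ₀ n) n) (sigmaSeq ν σ₀ n) 0 := by
      refine le_trans ?_ hgap
      rw [hexc, hsqrt]
      have hpos : 0 ≤ sqCdfSlope * (√σ₀ * R) := by have := sqCdfSlope_pos; positivity
      calc 2 * (c * R) = sqCdfSlope * (√σ₀ * R) * (γ / 2) := by rw [hc]; ring
        _ ≤ _ := by gcongr; linarith
    rw [hsqrt] at hv hu
    have hcR : 0 < c * R := by positivity
    refine ⟨?_, ?_, ?_, ?_⟩
    · linarith [hu.1]
    · linarith [hu.2]
    · linarith [hv.1]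
    · linarith [hv.2]
  refine ⟨σ₀, c, 4 * √σ₀ + 1, N, hσ0, hc0, by positivity, hσlim, ?_, ?_, ?_, ?_⟩
  · refine (sigmaSeq_eventuallyEq hν₂).trans_isTheta ?_
    exact (isTheta_refl _ _).const_mul_left hσ0.ne'
  · obtain ⟨M, hM⟩ := lintegral_axisLaw_le hν₂ hν₃
    refine ⟨M, fun n d => axisLaw ν (sigmaSeq ν σ₀ n) d,
      fun _ d x => decodePlane (firstCoord d x), fun n hn d hd => ?_, fun p hp K => ?_⟩
    · have h1 := (hN n hn.le).1
      have hs := hσpos n (by omega)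
      have := isProbabilityMeasure_threePointLaw hs.le (hscale n hn).2
      exact ⟨isRealization_axisLaw hd, hM _ hs (min_le_right _ _) (hscale n hn).2 d hd⟩
    · have hlim : Tendsto (sigmaSeq ν σ₀) atTop (𝓝[>] 0) := by
        refine tendsto_nhdsWithin_iff.2 ⟨hσlim, ?_⟩
        filter_upwards [eventually_gt_atTop 0] with n hn using hσpos n hn
      exact eventually_atTop.1 (hlim.eventually (eventually_le_lintegral_axisLaw hν₂ hp K))
  · intro n hn d μ φ hreal
    exact ⟨fun x y => planeKernelU_comm n _ _, fun x y => planeKernelV_comm n _ _,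
      hmain n hn d μ φ hreal⟩
  · intro hν d μ φ hreal
    have e : (-(ν - 2) / (4 * ν)) = (-(1 / 12) : ℝ) := by rw [hν]; norm_num
    simp only [e] at hmain
    refine ⟨isTheta_of_bounds (C := 4 * √σ₀ + 1) (N := N) hc0 (fun n => by positivity)
        fun n hn => ?_,
      isTheta_of_bounds (C := 4 * √σ₀ + 1) (N := N) hc0 (fun n => by positivity)
        fun n hn => ?_⟩
    · have := hmain n hn (d n) (μ n) (φ n) (hreal n hn)
      exact ⟨this.1, this.2.1⟩
    · have := hmain n hn (d n) (μ n) (φ n) (hreal n hn)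
      exact this.2.2
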